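/- **Theorem (soundness of the type-and-effect system with the rule tick:now).** *Language.* Base types are $\mathsf{Bool},\mathsf{Int},\mathsf{Rat}$. Types are base types, binary trees $\mathsf T_{\mathsf B}$ with labels of a base type $\mathsf B$, and products. Write $\mathsf T$ for $\mathsf T_{\mathsf B}$. Trees are $t::=\mathsf{leaf}\mid\langle t_1,b,t_2\rangle$. Values are constants, trees, and pairs of values. A type *carries a tree* if its values contain exactly one tree; we identify such a value with that tree when we speak of its size or rank. Expressions are $$\begin{aligned}e::={}&x\mid \text{constant}\mid f\,x_1\dots x_n\mid \checkmark^{c}e\mid x_1\circ x_2\mid \mathsf{if}\ g\ \mathsf{then}\ e_1\ \mathsf{else}\ e_2\mid \mathsf{leaf}\mid\langle x_1,x_2,x_3\rangle\mid(x_1,x_2)\\ &\mid\mathsf{match}\ x\ \mathsf{with}\,|\,\mathsf{leaf}\to e_1\,|\,\langle x_1,x_2,x_3\rangle\to e_2\mid \mathsf{match}\ x\ \mathsf{with}\,|\,(x_1,x_2)\to e\mid \mathsf{let}\ x=e_1\ \mathsf{in}\ e_2,\end{aligned}$$ where $\circ\in\{<,>,=\}$, $c\ge0$ is rational, and a guard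 $g$ is a variable, $\mathsf{nondet}$, or $\mathsf{coin}\ p$ with rational $p\in[0,1]$. A program $\mathsf P$ consists of definitions $f\,x_1\dots x_n=e_f$ and of annotated signatures (below). A substitution $\sigma$ maps variables to values, and $e\sigma$ is the result of replacing free variables. *Semantics.* A redex reduces with a cost to a distribution: $\checkmark^{c}e\mapsto e$ at cost $c$; all other reductions are free. They are the usual ones: $\mathsf{let}\ x=w\ \mathsf{in}\ e_2\mapsto e_2[x\mapsto w]$ for a value $w$, conditionals on Booleans, pattern matching with substitution of the components, unfolding of calls, comparison of constants of the same base type, $\mathsf{if}\ \mathsf{nondet}$ to either branch, and $\mathsf{if}\ \mathsf{coin}\ p\ \mathsf{then}\ e_1\ \mathsf{else}\ e_2\mapsto\{e_1^{p},e_2^{1-p}\}$. Evaluation contexts are $C::=\Box\mid\mathsf{let}\ x=C\ \mathsf{in}\ e$. On multidistributions (multisets of pairs of a probability and an expression), $\to^{c}$ is the least relation such that: $\{e^1\}\to^0\{e^1\}$ if $e$ is irreducible; $\{C[e]^1\}\to^c\{C[e_i]^{p_i}\}_i$ if $e\mapsto\{e_i^{p_i}\}_i$ at cost $c$; and $\biguplus_ip_i\mu_i\to^{\sum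 p_ic_i}\biguplus_ip_i\nu_i$ if $\mu_i\to^{c_i}\nu_i$ for all $i$ and $\sum_ip_i\le1$. We write $e\to^{c}_\infty\mu$ if there is a finite or infinite sequence $\{e^1\}\to^{c_1}\mu_1\to^{c_2}\mu_2\cdots$ with $c=\sum_nc_n\in[0,\infty]$ such that the subdistributions on values induced by the $\mu_n$ converge to $\mu$. *Potentials.* Let $|t|$ be the number of leaves of $t$, $\mathrm{rk}(\mathsf{leaf})=1$, $\mathrm{rk}(\langle l,b,r\rangle)=\mathrm{rk}(l)+\log_2|l|+\log_2|r|+\mathrm{rk}(r)$, and $\log_20:=0$. An annotation $Q$ of length $m$ consists of coefficients $q_i\ge0$ ($1\le i\le m$) and $q_{(\vec a,b)}\ge0$ ($\vec a\in\mathbb N^m$, $b\in\mathbb Z$, $\sum_ia_i+b\ge0$), almost all zero, and $$\Phi(t_1,\dots,t_m|Q)=\sum_iq_i\,\mathrm{rk}(t_i)+\sum_{\vec a,b}q_{(\vec a,b)}\log_2\Bigl(\sum_ia_i|t_i|+b\Bigr).$$ An annotation for a context $\Gamma$ is one for its tree-carrying variables, and $\Phi(\sigma;\Gamma|Q)$ is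 the potential of their values under $\sigma$. An annotation for a type $\alpha$ has length $1$ if $\alpha$ carries a tree (with coefficients $q'_*,q'_{(a,b)}$), and length $0$ otherwise; $\Phi(v|Q')$ is the potential of the value $v$. $Q+K$ adds $K$ to the coefficient of $p_{(\vec0,2)}=1$; sums and multiples are pointwise. *Typing.* There are three judgements $\Gamma|Q\vdash e:\alpha|Q'$: $\vdash$ (with costs), $\vdash^{\rm cf}$ (cost-free), and $\vdash^{\rm cf,nd}$ (cost-free, for the non-deterministic version of $e$). For each function there are three sets $\mathcal F(f),\mathcal F^{\rm cf}(f),\mathcal F^{\rm cf,nd}(f)$ of annotated types $\alpha_1\times\dots\times\alpha_n|Q\to\beta|Q'$. Variables written apart in a context are distinct, $Q$ is always an annotation for the context and $Q'$ for the type, and coefficients that a rule does not constrain are $0$. The rules are the same for the three judgements except where indicated; $p,q,r,\dots$ are the coefficients of $P,Q,R,\dots$. - *leaf*: $\varepsilon|Q+q'_*\vdash\mathsf{leaf}:\mathsf T|Q'$ if $q_{(c)}=\sum_{a+b=c}q'_{(a,b)}$ for $c\ge2$. - *node*: $x_1{:}\mathsf T,x_2{:}\mathsf B,x_3{:}\mathsf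 T|Q\vdash\langle x_1,x_2,x_3\rangle:\mathsf T|Q'$ if $q_1=q_2=q_{(1,0,0)}=q_{(0,1,0)}=q'_*$ and $q_{(a,a,c)}=q'_{(a,c)}$. - *constants, cmp, var*: $\varepsilon|Q\vdash b:\mathsf B|Q$; $x_1{:}\mathsf B,x_2{:}\mathsf B|Q\vdash x_1\circ x_2:\mathsf{Bool}|Q$; $x{:}\alpha|Q\vdash x:\alpha|Q$. - *pair*: $x_1{:}\alpha_1,x_2{:}\alpha_2|Q\vdash(x_1,x_2):\alpha_1\times\alpha_2|Q$ if $\alpha_1\times\alpha_2$ contains at most one tree. - *ite, nondet*: from $\Gamma|Q\vdash e_i:\alpha|Q'$ ($i=1,2$) infer $\Gamma,x{:}\mathsf{Bool}|Q\vdash\mathsf{if}\ x\ \mathsf{then}\ e_1\ \mathsf{else}\ e_2:\alpha|Q'$, and $\Gamma|Q\vdash\mathsf{if}\ \mathsf{nondet}\ \mathsf{then}\ e_1\ \mathsf{else}\ e_2:\alpha|Q'$. - *ite:coin*: for $\vdash,\vdash^{\rm cf}$: from $\Gamma|Q_i\vdash e_i:\alpha|Q'$ infer $\Gamma|pQ_1+(1-p)Q_2\vdash\mathsf{if}\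 \mathsf{coin}\ p\ \mathsf{then}\ e_1\ \mathsf{else}\ e_2:\alpha|Q'$. For $\vdash^{\rm cf,nd}$ a coin is typed like $\mathsf{nondet}$. - *tick:now*: from $\Gamma|Q\vdash e:\alpha|Q'$ infer $\Gamma|Q+c\vdash\checkmark^{c}e:\alpha|Q'$; for $\vdash^{\rm cf}$ and $\vdash^{\rm cf,nd}$ infer $\Gamma|Q\vdash\checkmark^ce:\alpha|Q'$. - *match*: from $\Gamma|P+q_{m+1}\vdash e_1:\alpha|Q'$ and $\Gamma,x_1{:}\mathsf T,x_2{:}\mathsf B,x_3{:}\mathsf T|R\vdash e_2:\alpha|Q'$ infer $\Gamma,x{:}\mathsf T|Q\vdash\mathsf{match}\ x\ \mathsf{with}\,|\,\mathsf{leaf}\to e_1\,|\,\langle x_1,x_2,x_3\rangle\to e_2:\alpha|Q'$, where $p_i=r_i=q_i$, $p_{(\vec a,c)}=\sum_{a+b=c}q_{(\vec a,a,b)}$, $r_{(\vec a,a,a,b)}=q_{(\vec a,a,b)}$, $r_{m+1}=r_{m+2}=r_{(\vec0,1,0,0)}=r_{(\vec0,0,1,0)}=q_{m+1}$. - *match:pair*: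 from $\Gamma,x_1{:}\alpha_1,x_2{:}\alpha_2|Q\vdash e:\beta|Q'$ infer $\Gamma,x{:}\alpha_1\times\alpha_2|Q\vdash\mathsf{match}\ x\ \mathsf{with}\,|\,(x_1,x_2)\to e:\beta|Q'$ if $\alpha_1\times\alpha_2$ contains at most one tree. - *let:base*: from $\Gamma|P\vdash e_1:\alpha|P'$ and $\Delta,x{:}\alpha|R\vdash e_2:\beta|Q'$ infer $\Gamma,\Delta|Q\vdash\mathsf{let}\ x=e_1\ \mathsf{in}\ e_2:\beta|Q'$ if $\alpha$ is not a tree type, $p_i=q_i$, $p_{(\vec a,c)}=q_{(\vec a,\vec0,c)}$, $r_j=q_{m+j}$, $r_{(\vec b,c)}=q_{(\vec0,\vec b,c)}$ for $\vec b\ne\vec0$, and $r_{(\vec0,c)}=p'_{(c)}$. - *let:tree*: the same inference for $\alpha$ carrying a tree, if $p_i=q_i$, $p_{(\vec a,c)}=q_{(\vec a,\vec0,c)}$, $r_j=q_{m+j}$, $r_{k+1}=p'_*$, $r_{(\vec0,d,e)}=p'_{(d,e)}$, $r_{(\vec b,0,c)}=q_{(\vec0,\vec b,c)}$ for $\vec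 b\ne\vec0$, and there are annotations $P^{(\vec b,d,e)}$, $P'^{(\vec b,d,e)}$ for $\vec b\ne\vec0$, $d\ne0$, $e\in\mathbb Z$, non-zero for finitely many indices only, such that (i) $\Gamma|P^{(\vec b,d,e)}\vdash^{\rm cf,nd}e_1:\alpha|P'^{(\vec b,d,e)}$ for those indices; (ii) $q_{(\vec a,\vec b,c)}=\sum_{(d,e)}p^{(\vec b,d,e)}_{(\vec a,c+\max\{-e,0\})}$ for $\vec a\ne\vec0\ne\vec b$; (iii) the only coefficient of $P'^{(\vec b,d,e)}$ that may be non-zero is $\kappa:=p'^{(\vec b,d,e)}_{(d,\max\{e,0\})}=r_{(\vec b,d,e)}$; (iv) $P^{(\vec b,d,e)}$ has non-zero coefficients only at $(\vec a,c)$ with $\vec a\ne\vec0$, $\sum_ia_i+c\ge1$, each of these is at least $\kappa$, and their sum is at least $\kappa$; (v) if $\kappa\ne0$, then $\sum_jb_j+e\ge0$. - *app*: $x_1{:}\alpha_1,\dots,x_n{:}\alpha_n|P+K Q\vdash f\,x_1\dots x_n:\beta|P'+K Q'$ if $K\ge0$, $\alpha_1\times\dots\times\alpha_n|P\to\beta|P'\in\mathcal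 F(f)$ and $\alpha_1\times\dots\times\alpha_n|Q\to\beta|Q'\in\mathcal F^{\rm cf}(f)$. For $\vdash^{\rm cf}$ both types are taken from $\mathcal F^{\rm cf}(f)$, for $\vdash^{\rm cf,nd}$ both from $\mathcal F^{\rm cf,nd}(f)$. - *structural rules*: weakening by a variable ($\Gamma,x{:}\alpha|Q\vdash e:\beta|Q'$ from $\Gamma|R\vdash e:\beta|Q'$ with $r_i=q_i$, $r_{(\vec a,b)}=q_{(\vec a,0,b)}$); sharing ($\Gamma,z{:}\alpha|\tilde Q\vdash e[z,z]:\beta|Q'$ from $\Gamma,x{:}\alpha,y{:}\alpha|Q\vdash e[x,y]:\beta|Q'$, with $\tilde q_z=q_x+q_y$, $\tilde q_{(\vec a,a,b)}=\sum_{a_1+a_2=a}q_{(\vec a,a_1,a_2,b)}$, and $z$ not bound in $e$); weakening of annotations ($\Gamma|Q\vdash e:\alpha|Q'$ from $\Gamma|P\vdash e:\alpha|P'$ if $\Phi(\sigma;\Gamma|P)\le\Phi(\sigma;\Gamma|Q)$ for all $\sigma$ and $\Phi(v|P')\ge\Phi(v|Q')$ for all values $v$ of type $\alpha$); shift ($\Gamma|Q+K\vdash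 e:\alpha|Q'+K$ from $\Gamma|Q\vdash e:\alpha|Q'$, $K\ge0$). $\mathsf P$ is *well-typed* if for each definition $f\,x_1\dots x_n=e_f$ and each annotated type $\alpha_1\times\dots\times\alpha_n|Q\to\beta|Q'$ in $\mathcal F(f)$, $\mathcal F^{\rm cf}(f)$ or $\mathcal F^{\rm cf,nd}(f)$ we have $x_1{:}\alpha_1,\dots,x_n{:}\alpha_n|Q\vdash e_f:\beta|Q'$ in the corresponding judgement. *Claim.* Let $\mathsf P$ be well-typed, let $\sigma$ be a substitution that assigns to each variable of $\Gamma$ a value of its type, and let $e\sigma\to^{c}_\infty\mu$, $c\in[0,\infty]$. If $\Gamma|Q\vdash e:\alpha|Q'$, then $$\Phi(\sigma;\Gamma|Q)\ \ge\ c+\mathbb E_\mu\bigl[\lambda v.\,\Phi(v|Q')\bigr].$$ If $\Gamma|Q\vdash^{\rm cf}e:\alpha|Q'$, then $\Phi(\sigma;\Gamma|Q)\ge\mathbb E_\mu[\lambda v.\,\Phi(v|Q')]$. -/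

import Mathlib

open scoped NNReal ENNReal Topology

noncomputable section

namespace ProbAmort

/-! ### Types, values, trees -/

/-- Base types. -/
inductive BTy
  | bool | int | rat
  deriving DecidableEq

/-- Constants of base type. -/
inductive Const
  | bool (b : Bool) | int (n : ℤ) | rat (q : ℚ)
  deriving DecidableEq

def Const.ty : Const → BTy
  | .bool _ => .bool
  | .int _ => .int
  | .rat _ => .rat

/-- Types: base types, binary trees with labels of a base type, products. -/
inductive Ty
  | base (B : BTy)
  | tree (B : BTy)
  | prod (α β : Ty)
  deriving DecidableEq

/-- Number of trees in a value of the given type. -/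
def Ty.numTrees : Ty → ℕ
  | .base _ => 0
  | .tree _ => 1
  | .prod α β => α.numTrees + β.numTrees

inductive Tree
  | leaf
  | node (l : Tree) (b : Const) (r : Tree)

namespace Tree

/-- The size of a tree is its number of leaves. -/
def size : Tree → ℕ
  | leaf => 1
  | node l _ r => l.size + r.size

/-- The rank of a tree (a variant of Schoenmakers' potential). -/
def rk : Tree → ℝ
  | leaf => 1
  | node l _ r => l.rk + Real.logb 2 l.size + Real.logb 2 r.size + r.rk

/-- All labels are of base type `B`. -/
def HasLabels (B : BTy) : Tree → Prop
  | leaf => True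
  | node l b r => l.HasLabels B ∧ b.ty = B ∧ r.HasLabels B

end Tree

inductive Value
  | const (c : Const)
  | tree (t : Tree)
  | pair (v w : Value)

def Value.HasTy : Value → Ty → Prop
  | .const c, .base B => c.ty = B
  | .tree t, .tree B => t.HasLabels B
  | .pair v w, .prod α β => v.HasTy α ∧ w.HasTy β
  | _, _ => False

/-- The (first) tree inside a value, if there is one. -/
def Value.tree? : Value → Option Tree
  | .const _ => none
  | .tree t => some t
  | .pair v w => v.tree?.or w.tree?

/-! ### Expressions -/

abbrev Var := ℕ

abbrev FName := ℕ

inductive Cmp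
  | lt | gt | eq

/-- An argument position: a variable, or the value that has replaced it. -/
inductive Atom
  | var (x : Var)
  | val (v : Value)

/-- Expressions in let-normal form. The cost `a/b` of a tick is a non-negative rational, the
probability `a/b` of a coin a rational in `[0, 1]`. -/
inductive Expr
  | atom (a : Atom)
  | call (f : FName) (args : List Atom)
  | tick (c : ℚ≥0) (e : Expr)
  | cmp (o : Cmp) (a₁ a₂ : Atom)
  | ite (a : Atom) (e₁ e₂ : Expr)
  | nondet (e₁ e₂ : Expr)
  | coin (p : {p : ℚ≥0 // p ≤ 1}) (e₁ e₂ : Expr)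
  | leaf
  | node (a₁ a₂ a₃ : Atom)
  | matchTree (a : Atom) (e₁ : Expr) (x₁ x₂ x₃ : Var) (e₂ : Expr)
  | pair (a₁ a₂ : Atom)
  | matchPair (a : Atom) (x₁ x₂ : Var) (e : Expr)
  | letIn (x : Var) (e₁ e₂ : Expr)

/-- Substitutions (environments): partial maps from variables to (closed) values. -/
abbrev Subst := Var → Option Value

def Subst.erase (σ : Subst) (xs : List Var) : Subst := fun y => if y ∈ xs then none else σ y

/-- The substitution `{xs i ↦ vs i}`. -/
def Subst.ofLists (xs : List Var) (vs : List Value) : Subst := fun y => (xs.zip vs).lookup y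

def Atom.subst (σ : Subst) : Atom → Atom
  | .var x => match σ x with
    | some v => .val v
    | none => .var x
  | .val v => .val v

/-- `e.subst σ` is `eσ`. -/
def Expr.subst : Expr → Subst → Expr
  | .atom a, σ => .atom (a.subst σ)
  | .call f as, σ => .call f (as.map (Atom.subst σ))
  | .tick c e, σ => .tick c (e.subst σ)
  | .cmp o a₁ a₂, σ => .cmp o (a₁.subst σ) (a₂.subst σ)
  | .ite a e₁ e₂, σ => .ite (a.subst σ) (e₁.subst σ) (e₂.subst σ)
  | .nondet e₁ e₂, σ => .nondet (e₁.subst σ) (e₂.subst σ)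
  | .coin p e₁ e₂, σ => .coin p (e₁.subst σ) (e₂.subst σ)
  | .leaf, _ => .leaf
  | .node a₁ a₂ a₃, σ => .node (a₁.subst σ) (a₂.subst σ) (a₃.subst σ)
  | .matchTree a e₁ x₁ x₂ x₃ e₂, σ =>
      .matchTree (a.subst σ) (e₁.subst σ) x₁ x₂ x₃ (e₂.subst (σ.erase [x₁, x₂, x₃]))
  | .pair a₁ a₂, σ => .pair (a₁.subst σ) (a₂.subst σ)
  | .matchPair a x₁ x₂ e, σ => .matchPair (a.subst σ) x₁ x₂ (e.subst (σ.erase [x₁, x₂]))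
  | .letIn x e₁ e₂, σ => .letIn x (e₁.subst σ) (e₂.subst (σ.erase [x]))

def Atom.rename (ρ : Var → Var) : Atom → Atom
  | .var x => .var (ρ x)
  | .val v => .val v

/-- Renaming with `ρ`, except for the variables `xs`. -/
def renameExcept (ρ : Var → Var) (xs : List Var) : Var → Var := fun y => if y ∈ xs then y else ρ y

/-- Renaming of the free variables (to be used where no capture is possible). -/
def Expr.rename : Expr → (Var → Var) → Expr
  | .atom a, ρ => .atom (a.rename ρ)
  | .call f as, ρ => .call f (as.map (Atom.rename ρ))
  | .tick c e, ρ => .tick c (e.rename ρ)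
  | .cmp o a₁ a₂, ρ => .cmp o (a₁.rename ρ) (a₂.rename ρ)
  | .ite a e₁ e₂, ρ => .ite (a.rename ρ) (e₁.rename ρ) (e₂.rename ρ)
  | .nondet e₁ e₂, ρ => .nondet (e₁.rename ρ) (e₂.rename ρ)
  | .coin p e₁ e₂, ρ => .coin p (e₁.rename ρ) (e₂.rename ρ)
  | .leaf, _ => .leaf
  | .node a₁ a₂ a₃, ρ => .node (a₁.rename ρ) (a₂.rename ρ) (a₃.rename ρ)
  | .matchTree a e₁ x₁ x₂ x₃ e₂, ρ =>
      .matchTree (a.rename ρ) (e₁.rename ρ) x₁ x₂ x₃ (e₂.rename (renameExcept ρ [x₁, x₂, x₃]))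
  | .pair a₁ a₂, ρ => .pair (a₁.rename ρ) (a₂.rename ρ)
  | .matchPair a x₁ x₂ e, ρ => .matchPair (a.rename ρ) x₁ x₂ (e.rename (renameExcept ρ [x₁, x₂]))
  | .letIn x e₁ e₂, ρ => .letIn x (e₁.rename ρ) (e₂.rename (renameExcept ρ [x]))

/-- The variables bound somewhere in an expression. -/
def Expr.binders : Expr → List Var
  | .tick _ e => e.binders
  | .ite _ e₁ e₂ => e₁.binders ++ e₂.binders
  | .nondet e₁ e₂ => e₁.binders ++ e₂.binders
  | .coin _ e₁ e₂ => e₁.binders ++ e₂.binders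
  | .matchTree _ e₁ x₁ x₂ x₃ e₂ => [x₁, x₂, x₃] ++ e₁.binders ++ e₂.binders
  | .matchPair _ x₁ x₂ e => [x₁, x₂] ++ e.binders
  | .letIn x e₁ e₂ => x :: (e₁.binders ++ e₂.binders)
  | _ => []

/-- The value that an expression is, if it is a value. -/
def Expr.toValue : Expr → Option Value
  | .atom (.val v) => some v
  | .leaf => some (.tree .leaf)
  | .node (.val (.tree t)) (.val (.const b)) (.val (.tree u)) => some (.tree (.node t b u))
  | .pair (.val v) (.val w) => some (.pair v w)
  | _ => none

/-! ### Resource annotations and potentials -/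

/-- Resource annotations of a family of trees indexed by `V`: the coefficients `q_x` of the ranks,
and the coefficients `q_(a,b)` of the functions `log₂ (∑ x, a x * |t x| + b)`. -/
@[ext]
structure Annot (V : Type) where
  rk : V →₀ ℝ≥0
  lg : (V →₀ ℕ) × ℤ →₀ ℝ≥0

namespace Annot

variable {V W : Type}

instance : Zero (Annot V) := ⟨⟨0, 0⟩⟩

instance : Add (Annot V) := ⟨fun P Q => ⟨P.rk + Q.rk, P.lg + Q.lg⟩⟩

instance : SMul ℝ≥0 (Annot V) := ⟨fun K Q => ⟨K • Q.rk, K • Q.lg⟩⟩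

/-- `Q + K`, where the constant function `1` is `p_(0,2)`. -/
def addConst (Q : Annot V) (K : ℝ≥0) : Annot V := ⟨Q.rk, Q.lg + Finsupp.single (0, 2) K⟩

/-- Change of the index family. If `f` identifies indices, coefficients are collected:
`q_z = ∑ x ∈ f⁻¹ z, q_x`, and likewise the vectors `a` and the coefficients `q_(a,b)`. -/
def rename (f : V → W) (Q : Annot V) : Annot W :=
  ⟨Q.rk.mapDomain f, Q.lg.mapDomain fun i => (i.1.mapDomain f, i.2)⟩

open Classical in
/-- The part of an annotation that concerns only the trees in `S` (with the constants). -/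
def restrict (S : Set V) (Q : Annot V) : Annot V :=
  ⟨Q.rk.filter (· ∈ S), Q.lg.filter fun i => ↑i.1.support ⊆ S⟩

/-- The sum of the components of an index vector. -/
def weight (a : V →₀ ℕ) : ℤ := a.sum fun _ n => (n : ℤ)

/-- `Q` is an annotation for the trees with index in `S`, and each function
`log₂ (∑ x, a x * |t x| + b)` in it is well-defined. -/
def On (S : Set V) (Q : Annot V) : Prop :=
  ↑Q.rk.support ⊆ S ∧ ∀ i ∈ Q.lg.support, ↑i.1.support ⊆ S ∧ 0 ≤ weight i.1 + i.2

/-- The resource function `p_(a,b)` of a family of trees; note that `Real.logb 2 0 = 0`. -/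
def logFun (i : (V →₀ ℕ) × ℤ) (t : V → Tree) : ℝ :=
  Real.logb 2 (((i.1.sum fun x n => (n : ℤ) * ((t x).size : ℤ)) + i.2 : ℤ) : ℝ)

/-- The potential of a family of trees with respect to an annotation. -/
def pot (Q : Annot V) (t : V → Tree) : ℝ :=
  (Q.rk.sum fun x q => (q : ℝ) * (t x).rk) + Q.lg.sum fun i q => (q : ℝ) * logFun i t

end Annot

/-- The potential `Φ(v|Q')` of a value; `Q'` has length one if the value contains a tree, and
consists of constants otherwise. -/
def valPot (v : Value) (Q : Annot Unit) : ℝ := Q.pot fun _ => v.tree?.getD .leaf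

/-- The potential `Φ(σ;Γ|Q)` of a context; the variables of `Γ` that carry a tree index `Q`. -/
def ctxPot (σ : Subst) (Q : Annot Var) : ℝ :=
  Q.pot fun x => ((σ x).bind Value.tree?).getD .leaf

/-! ### Typing contexts -/

/-- Typing contexts: (partial) maps from variables to types. -/
abbrev Ctx := Var → Option Ty

namespace Ctx

def empty : Ctx := fun _ => none

def ext (Γ : Ctx) (x : Var) (α : Ty) : Ctx := Function.update Γ x (some α)

/-- The context `x₁ : α₁, …, xₙ : αₙ`. -/
def ofLists (xs : List Var) (αs : List Ty) : Ctx := fun y => (xs.zip αs).lookup y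

def Disj (Γ Δ : Ctx) : Prop := ∀ x, Γ x = none ∨ Δ x = none

def union (Γ Δ : Ctx) : Ctx := fun x => (Γ x).or (Δ x)

/-- The variables that carry a tree. -/
def trees (Γ : Ctx) : Set Var := {x | ∃ α, Γ x = some α ∧ α.numTrees = 1}

end Ctx

/-- `σ` is defined on `Γ` and respects the types. -/
def Subst.Respects (σ : Subst) (Γ : Ctx) : Prop :=
  ∀ x α, Γ x = some α → ∃ v, σ x = some v ∧ v.HasTy α

/-- `Q` is an annotation for `Γ`, and `Q'` one for the result type `α`. -/
def AnnotsFor (Γ : Ctx) (Q : Annot Var) (α : Ty) (Q' : Annot Unit) : Prop :=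
  Q.On Γ.trees ∧ Q'.On {_u | α.numTrees = 1}

/-! ### Annotated signatures and programs -/

/-- The three variants of the type system: the one with costs (ticks are paid by the rule
`tick:now`), the cost-free one (ticks are ignored), and the cost-free one for the non-deterministic
version of an expression (moreover, each coin is read as a non-deterministic choice). -/
inductive Mode
  | cost | cf | cfnd

/-- The signatures that may be added with a factor `K` in the application rule. -/
def Mode.free : Mode → Mode
  | .cost => .cf
  | .cf => .cf
  | .cfnd => .cfnd

/-- What the typing of a tick of cost `c` has to pay. -/
def Mode.charge : Mode → ℚ≥0 → ℝ≥0
  | .cost, c => c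
  | .cf, _ => 0
  | .cfnd, _ => 0

/-- An annotated function type `α₁ × ⋯ × αₙ|Q → β|Q'`; `Q` is indexed by the argument positions
that carry a tree, and `Q'` is an annotation for the result type. -/
structure FunSig where
  args : List Ty
  inp : Annot ℕ
  res : Ty
  out : Annot Unit
  inp_on : inp.On {i | ∃ α, args[i]? = some α ∧ α.numTrees = 1}
  out_on : out.On {_u | res.numTrees = 1}

/-- A function definition `f x₁ … xₙ = e`. -/
structure FunDef where
  params : List Var
  nodup : params.Nodup
  body : Expr

/-- A program: annotated signatures (with costs, cost-free, and cost-free non-deterministic)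
and function definitions. -/
structure Program where
  sig : Mode → FName → Set FunSig
  defs : FName → Option FunDef

/-! ### The type-and-effect system

Coefficients that are not constrained in a rule are zero. -/

/-- The variable in a pair of variables that carries the tree. -/
def treeVar (x₁ x₂ : Var) (α₁ : Ty) : Var := if α₁.numTrees = 1 then x₁ else x₂

/-- For a tree `t = leaf` at `x`: `p_(a,c) = ∑_{k+b=c} q_(a,k,b)` and `p_i = q_i`. -/
def Annot.atLeaf (x : Var) (Q : Annot Var) : Annot Var :=
  ⟨Q.rk.erase x, Q.lg.mapDomain fun i => (i.1.erase x, (i.1 x : ℤ) + i.2)⟩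

/-- For a tree at `x` that is a node with subtrees at `x₁` and `x₃`:
`r_i = q_i`, `r_{x₁} = r_{x₃} = q_x`, `r_(0,1,0,0) = r_(0,0,1,0) = q_x`, and
`r_(a,k,k,b) = q_(a,k,b)`. -/
def Annot.atNode (x x₁ x₃ : Var) (Q : Annot Var) : Annot Var :=
  ⟨Q.rk.erase x + Finsupp.single x₁ (Q.rk x) + Finsupp.single x₃ (Q.rk x),
   (Q.lg.mapDomain fun i =>
      (i.1.erase x + Finsupp.single x₁ (i.1 x) + Finsupp.single x₃ (i.1 x), i.2)) +
    Finsupp.single (Finsupp.single x₁ 1, 0) (Q.rk x) +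
    Finsupp.single (Finsupp.single x₃ 1, 0) (Q.rk x)⟩

open Classical in
/-- The input annotation of `leaf`: `q_(c) = ∑_{a+b=c} q'_(a,b)` for `c ≥ 2`. -/
def leafInput (Q' : Annot Unit) : Annot Var :=
  ⟨0, (Q'.lg.mapDomain fun i => (0, (i.1 () : ℤ) + i.2)).filter fun i => 2 ≤ i.2⟩

/-- The constants of `P'`, and what `Q` says about `Δ` beyond constants. -/
def letBaseAnnot (Δ : Ctx) (Q : Annot Var) (P' : Annot Unit) : Annot Var :=
  ⟨(Q.restrict Δ.trees).rk,
   (Q.restrict Δ.trees).lg.filter (fun i => i.1 ≠ 0) +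
     (P'.lg.filter fun i => i.1 = 0).mapDomain fun i => (0, i.2)⟩

/-- The cost-free annotation `P'^(b,d,e)`: its only coefficient is `κ` at `(d, max e 0)`. -/
def sideOut (d : ℕ) (e : ℤ) (κ : ℝ≥0) : Annot Unit :=
  ⟨0, Finsupp.single (Finsupp.single () d, max e 0) κ⟩

/-- The arithmetical constraints of the let rule for trees. The finite set `I` holds the
`(b, d, e)` for which the annotations `P^(b,d,e)` and `P'^(b,d,e)` (with the coefficient
`κ (b, d, e)`) need not vanish. -/
structure LetTreeConstraints (Γ Δ : Ctx) (x : Var) (Q : Annot Var) (P' : Annot Unit)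
    (R : Annot Var) (I : Finset ((Var →₀ ℕ) × ℕ × ℤ))
    (p : (Var →₀ ℕ) × ℕ × ℤ → Annot Var) (κ : (Var →₀ ℕ) × ℕ × ℤ → ℝ≥0) : Prop where
  rk_old : ∀ y ∈ Δ.trees, R.rk y = Q.rk y
  rk_new : R.rk x = P'.rk ()
  lg_new : ∀ (d : ℕ) (e : ℤ),
    R.lg (Finsupp.single x d, e) = P'.lg (Finsupp.single () d, e)
  lg_old : ∀ (b : Var →₀ ℕ) (c : ℤ), b ≠ 0 → ↑b.support ⊆ Δ.trees → R.lg (b, c) = Q.lg (b, c)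
  index : ∀ j ∈ I, j.1 ≠ 0 ∧ ↑j.1.support ⊆ Δ.trees ∧ j.2.1 ≠ 0
  lg_mixed : ∀ (a b : Var →₀ ℕ) (c : ℤ), a ≠ 0 → ↑a.support ⊆ Γ.trees →
    b ≠ 0 → ↑b.support ⊆ Δ.trees →
    Q.lg (a + b, c) = ∑ j ∈ I with j.1 = b, (p j).lg (a, c + max (-j.2.2) 0)
  lg_out : ∀ j ∈ I, R.lg (j.1 + Finsupp.single x j.2.1, j.2.2) = κ j
  lg_zero : ∀ (b : Var →₀ ℕ) (d : ℕ) (e : ℤ), b ≠ 0 → ↑b.support ⊆ Δ.trees → d ≠ 0 →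
    (b, d, e) ∉ I → R.lg (b + Finsupp.single x d, e) = 0
  side_rk : ∀ j ∈ I, (p j).rk = 0
  side_const : ∀ j ∈ I, ∀ c : ℤ, (p j).lg (0, c) = 0
  side_sum : ∀ j ∈ I, κ j ≤ (p j).lg.sum fun _ q => q
  side_le : ∀ j ∈ I, ∀ i, i.1 ≠ 0 → (p j).lg i ≠ 0 → κ j ≤ (p j).lg i
  side_pos : ∀ j ∈ I, ∀ i, (p j).lg i ≠ 0 → 1 ≤ Annot.weight i.1 + i.2
  side_shift : ∀ j ∈ I, κ j ≠ 0 → 0 ≤ Annot.weight j.1 + j.2.2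

/-- The typing judgement `Γ|Q ⊢ e : α|Q'`, in its three variants. -/
inductive Typed (F : Mode → FName → Set FunSig) :
    Mode → Ctx → Annot Var → Expr → Ty → Annot Unit → Prop
  -- syntax-directed rules
  | leaf {m : Mode} {B : BTy} {Q' : Annot Unit}
      (wf : AnnotsFor .empty ((leafInput Q').addConst (Q'.rk ())) (.tree B) Q') :
      Typed F m .empty ((leafInput Q').addConst (Q'.rk ())) .leaf (.tree B) Q'
  | node {m : Mode} {B : BTy} {x₁ x₂ x₃ : Var} {Q : Annot Var} {Q' : Annot Unit}
      (hx : [x₁, x₂, x₃].Nodup)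
      (hQ : Q = (Q'.rename fun _ => x₁).atNode x₁ x₁ x₃)
      (wf : AnnotsFor (.ofLists [x₁, x₂, x₃] [.tree B, .base B, .tree B]) Q (.tree B) Q') :
      Typed F m (.ofLists [x₁, x₂, x₃] [.tree B, .base B, .tree B]) Q
        (.node (.var x₁) (.var x₂) (.var x₃)) (.tree B) Q'
  | const {m : Mode} {c} {Q' : Annot Unit}
      (wf : AnnotsFor .empty (Q'.rename fun _ => 0) (.base c.ty) Q') :
      Typed F m .empty (Q'.rename fun _ => 0) (.atom (.val (.const c))) (.base c.ty) Q'
  | cmp {m : Mode} {o : Cmp} {B : BTy} {x₁ x₂ : Var} {Q' : Annot Unit}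
      (hx : x₁ ≠ x₂)
      (wf : AnnotsFor (.ofLists [x₁, x₂] [.base B, .base B]) (Q'.rename fun _ => x₁)
        (.base .bool) Q') :
      Typed F m (.ofLists [x₁, x₂] [.base B, .base B]) (Q'.rename fun _ => x₁)
        (.cmp o (.var x₁) (.var x₂)) (.base .bool) Q'
  | var {m : Mode} {x : Var} {α : Ty} {Q' : Annot Unit}
      (wf : AnnotsFor (.ofLists [x] [α]) (Q'.rename fun _ => x) α Q') :
      Typed F m (.ofLists [x] [α]) (Q'.rename fun _ => x) (.atom (.var x)) α Q'
  | pair {m : Mode} {x₁ x₂ : Var} {α₁ α₂ : Ty} {Q' : Annot Unit}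
      (hx : x₁ ≠ x₂) (hα : α₁.numTrees + α₂.numTrees ≤ 1)
      (wf : AnnotsFor (.ofLists [x₁, x₂] [α₁, α₂]) (Q'.rename fun _ => treeVar x₁ x₂ α₁)
        (.prod α₁ α₂) Q') :
      Typed F m (.ofLists [x₁, x₂] [α₁, α₂]) (Q'.rename fun _ => treeVar x₁ x₂ α₁)
        (.pair (.var x₁) (.var x₂)) (.prod α₁ α₂) Q'
  | ite {m : Mode} {Γ : Ctx} {x : Var} {Q : Annot Var} {e₁ e₂ : Expr} {α : Ty} {Q' : Annot Unit}
      (hx : Γ x = none)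
      (h₁ : Typed F m Γ Q e₁ α Q') (h₂ : Typed F m Γ Q e₂ α Q')
      (wf : AnnotsFor (Γ.ext x (.base .bool)) Q α Q') :
      Typed F m (Γ.ext x (.base .bool)) Q (.ite (.var x) e₁ e₂) α Q'
  | nondet {m : Mode} {Γ : Ctx} {Q : Annot Var} {e₁ e₂ : Expr} {α : Ty} {Q' : Annot Unit}
      (h₁ : Typed F m Γ Q e₁ α Q') (h₂ : Typed F m Γ Q e₂ α Q')
      (wf : AnnotsFor Γ Q α Q') :
      Typed F m Γ Q (.nondet e₁ e₂) α Q'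
  | coin {m : Mode} {Γ : Ctx} {Q Q₁ Q₂ : Annot Var} {p} {e₁ e₂ : Expr} {α : Ty} {Q' : Annot Unit}
      (hm : m ≠ .cfnd)
      (h₁ : Typed F m Γ Q₁ e₁ α Q') (h₂ : Typed F m Γ Q₂ e₂ α Q')
      (hQ : Q = (p.1 : ℝ≥0) • Q₁ + (1 - (p.1 : ℝ≥0)) • Q₂)
      (wf : AnnotsFor Γ Q α Q') :
      Typed F m Γ Q (.coin p e₁ e₂) α Q'
  | coinNondet {Γ : Ctx} {Q : Annot Var} {p} {e₁ e₂ : Expr} {α : Ty} {Q' : Annot Unit}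
      (h₁ : Typed F .cfnd Γ Q e₁ α Q') (h₂ : Typed F .cfnd Γ Q e₂ α Q')
      (wf : AnnotsFor Γ Q α Q') :
      Typed F .cfnd Γ Q (.coin p e₁ e₂) α Q'
  | tickNow {m : Mode} {Γ : Ctx} {Q : Annot Var} {c} {e : Expr} {α : Ty} {Q' : Annot Unit}
      (h : Typed F m Γ Q e α Q')
      (wf : AnnotsFor Γ (Q.addConst (m.charge c)) α Q') :
      Typed F m Γ (Q.addConst (m.charge c)) (.tick c e) α Q'
  | matchTree {m : Mode} {Γ : Ctx} {x : Var} {B : BTy} {Q : Annot Var} {e₁ : Expr}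
      {x₁ x₂ x₃ : Var} {e₂ : Expr} {α : Ty} {Q' : Annot Unit}
      (hx : Γ x = none)
      (hd : [x₁, x₂, x₃].Nodup) (hx₁ : Γ x₁ = none) (hx₂ : Γ x₂ = none) (hx₃ : Γ x₃ = none)
      (h₁ : Typed F m Γ ((Q.atLeaf x).addConst (Q.rk x)) e₁ α Q')
      (h₂ : Typed F m (((Γ.ext x₁ (.tree B)).ext x₂ (.base B)).ext x₃ (.tree B))
        (Q.atNode x x₁ x₃) e₂ α Q')
      (wf : AnnotsFor (Γ.ext x (.tree B)) Q α Q') :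
      Typed F m (Γ.ext x (.tree B)) Q (.matchTree (.var x) e₁ x₁ x₂ x₃ e₂) α Q'
  | matchPair {m : Mode} {Γ : Ctx} {x : Var}
      {α₁ α₂ β : Ty} {Q : Annot Var} {x₁ x₂ : Var} {e : Expr} {Q' : Annot Unit}
      (hx : Γ x = none) (hd : x₁ ≠ x₂) (hx₁ : Γ x₁ = none) (hx₂ : Γ x₂ = none)
      (hα : α₁.numTrees + α₂.numTrees ≤ 1)
      (h : Typed F m ((Γ.ext x₁ α₁).ext x₂ α₂)
        (Q.rename (Function.update id x (treeVar x₁ x₂ α₁))) e β Q')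
      (wf : AnnotsFor (Γ.ext x (.prod α₁ α₂)) Q β Q') :
      Typed F m (Γ.ext x (.prod α₁ α₂)) Q (.matchPair (.var x) x₁ x₂ e) β Q'
  | letBase {m : Mode} {Γ Δ : Ctx} {x : Var} {α : Ty} {Q : Annot Var} {P' : Annot Unit}
      {e₁ e₂ : Expr} {β : Ty} {Q' : Annot Unit}
      (hΓ : Γ.Disj Δ) (hx : Δ x = none)
      (hα : ∀ B, α ≠ .tree B)
      (h₁ : Typed F m Γ (Q.restrict Γ.trees) e₁ α P')
      (h₂ : Typed F m (Δ.ext x α) (letBaseAnnot Δ Q P') e₂ β Q')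
      (wf : AnnotsFor (Γ.union Δ) Q β Q') :
      Typed F m (Γ.union Δ) Q (.letIn x e₁ e₂) β Q'
  | letTree {m : Mode} {Γ Δ : Ctx} {x : Var} {α : Ty} {Q : Annot Var} {P' : Annot Unit}
      {R : Annot Var} {I : Finset ((Var →₀ ℕ) × ℕ × ℤ)} {p κ} {e₁ e₂ : Expr} {β : Ty}
      {Q' : Annot Unit}
      (hΓ : Γ.Disj Δ) (hx : Δ x = none)
      (hα : α.numTrees = 1)
      (hc : LetTreeConstraints Γ Δ x Q P' R I p κ)
      (h₁ : Typed F m Γ (Q.restrict Γ.trees) e₁ α P')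
      (hside : ∀ j ∈ I, Typed F .cfnd Γ (p j) e₁ α (sideOut j.2.1 j.2.2 (κ j)))
      (h₂ : Typed F m (Δ.ext x α) R e₂ β Q')
      (wf : AnnotsFor (Γ.union Δ) Q β Q') :
      Typed F m (Γ.union Δ) Q (.letIn x e₁ e₂) β Q'
  | app {m : Mode} {f : FName} {s s' : FunSig} {K : ℝ≥0} {xs : List Var} {Q : Annot Var}
      {Q' : Annot Unit}
      (hs : s ∈ F m f) (hs' : s' ∈ F m.free f)
      (hargs : s'.args = s.args) (hres : s'.res = s.res)
      (hx : xs.Nodup) (hlen : xs.length = s.args.length)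
      (hQ : Q = (s.inp + K • s'.inp).rename fun i => xs.getD i 0)
      (hQ' : Q' = s.out + K • s'.out)
      (wf : AnnotsFor (.ofLists xs s.args) Q s.res Q') :
      Typed F m (.ofLists xs s.args) Q (.call f (xs.map .var)) s.res Q'
  -- structural rules
  | weakenVar {m : Mode} {Γ : Ctx} {x : Var} {α : Ty} {Q : Annot Var} {e : Expr} {β : Ty}
      {Q' : Annot Unit}
      (hx : Γ x = none)
      (h : Typed F m Γ (Q.restrict Γ.trees) e β Q')
      (wf : AnnotsFor (Γ.ext x α) Q β Q') :
      Typed F m (Γ.ext x α) Q e β Q'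
  | share {m : Mode} {Γ : Ctx} {x y z : Var} {α : Ty} {Q : Annot Var} {e : Expr} {β : Ty}
      {Q' : Annot Unit}
      (hxy : x ≠ y) (hx : Γ x = none) (hy : Γ y = none)
      (hz : Γ z = none) (hb : z ∉ e.binders)
      (h : Typed F m ((Γ.ext x α).ext y α) Q e β Q')
      (wf : AnnotsFor (Γ.ext z α)
        (Q.rename (Function.update (Function.update id x z) y z)) β Q') :
      Typed F m (Γ.ext z α) (Q.rename (Function.update (Function.update id x z) y z))
        (e.rename (Function.update (Function.update id x z) y z)) β Q'
  | weaken {m : Mode} {Γ : Ctx} {P Q : Annot Var} {e : Expr} {α : Ty} {P' Q' : Annot Unit}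
      (h : Typed F m Γ P e α P')
      (hQ : ∀ σ : Subst, σ.Respects Γ → ctxPot σ P ≤ ctxPot σ Q)
      (hQ' : ∀ v : Value, v.HasTy α → valPot v Q' ≤ valPot v P')
      (wf : AnnotsFor Γ Q α Q') :
      Typed F m Γ Q e α Q'
  | shift {m : Mode} {Γ : Ctx} {Q : Annot Var} {e : Expr} {α : Ty} {Q' : Annot Unit} {K : ℝ≥0}
      (h : Typed F m Γ Q e α Q')
      (wf : AnnotsFor Γ (Q.addConst K) α (Q'.addConst K)) :
      Typed F m Γ (Q.addConst K) e α (Q'.addConst K)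

/-- Every function body has all the annotated types that the signatures (with costs, cost-free,
cost-free non-deterministic) declare for the function. -/
def Program.WellTyped (P : Program) : Prop :=
  ∀ (m : Mode) (f : FName) (d : FunDef), P.defs f = some d → ∀ s ∈ P.sig m f,
    d.params.length = s.args.length ∧
    Typed P.sig m (.ofLists d.params s.args) (s.inp.rename fun i => d.params.getD i 0)
      d.body s.res s.out

/-! ### Small-step semantics -/

/-- Multidistributions. Only finite ones can be reached from a Dirac multidistribution; that the
probabilities are positive with sum at most one is preserved by reduction. -/
abbrev MDist (A : Type) := Multiset (ℝ≥0 × A)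

def MDist.scale {A : Type} (p : ℝ≥0) (μ : MDist A) : MDist A := μ.map fun x => (p * x.1, x.2)

def Cmp.eval {A : Type} [LinearOrder A] : Cmp → A → A → Bool
  | .lt, a, b => decide (a < b)
  | .gt, a, b => decide (b < a)
  | .eq, a, b => decide (a = b)

/-- Comparison of two constants of the same base type. -/
def Cmp.evalConst (o : Cmp) : Const → Const → Option Bool
  | .bool a, .bool b => some (o.eval a b)
  | .int a, .int b => some (o.eval a b)
  | .rat a, .rat b => some (o.eval a b)
  | _, _ => none

open Classical in
/-- One-step reduction of redexes, with its cost and its distribution of reducts. -/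
inductive Red (P : Program) : Expr → ℝ≥0 → MDist Expr → Prop
  | letIn {x w v e} : w.toValue = some v →
      Red P (.letIn x w e) 0 {(1, e.subst (.ofLists [x] [v]))}
  | iteTrue {e₁ e₂} : Red P (.ite (.val (.const (.bool true))) e₁ e₂) 0 {(1, e₁)}
  | iteFalse {e₁ e₂} : Red P (.ite (.val (.const (.bool false))) e₁ e₂) 0 {(1, e₂)}
  | coin {p e₁ e₂} : Red P (.coin p e₁ e₂) 0
      (({((p.1 : ℝ≥0), e₁), (1 - (p.1 : ℝ≥0), e₂)} : MDist Expr).filter fun x => 0 < x.1)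
  | nondetLeft {e₁ e₂} : Red P (.nondet e₁ e₂) 0 {(1, e₁)}
  | nondetRight {e₁ e₂} : Red P (.nondet e₁ e₂) 0 {(1, e₂)}
  | matchLeaf {e₁ x₁ x₂ x₃ e₂} :
      Red P (.matchTree (.val (.tree .leaf)) e₁ x₁ x₂ x₃ e₂) 0 {(1, e₁)}
  | matchNode {t b u e₁ x₁ x₂ x₃ e₂} :
      Red P (.matchTree (.val (.tree (.node t b u))) e₁ x₁ x₂ x₃ e₂) 0
        {(1, e₂.subst (.ofLists [x₁, x₂, x₃] [.tree t, .const b, .tree u]))}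
  | matchPair {v w x₁ x₂ e} :
      Red P (.matchPair (.val (.pair v w)) x₁ x₂ e) 0 {(1, e.subst (.ofLists [x₁, x₂] [v, w]))}
  | call {f d vs} : P.defs f = some d → d.params.length = vs.length →
      Red P (.call f (vs.map .val)) 0 {(1, d.body.subst (.ofLists d.params vs))}
  | tick {c e} : Red P (.tick c e) c {(1, e)}
  | cmp {o a b r} : Cmp.evalConst o a b = some r →
      Red P (.cmp o (.val (.const a)) (.val (.const b))) 0
        {(1, .atom (.val (.const (.bool r))))}

/-- Evaluation contexts. -/
inductive ECtx
  | hole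
  | letIn (x : Var) (C : ECtx) (e : Expr)

def ECtx.fill : ECtx → Expr → Expr
  | .hole, e => e
  | .letIn x C e₂, e => .letIn x (C.fill e) e₂

/-- No reduction is possible. -/
def Terminal (P : Program) (e : Expr) : Prop :=
  ¬ ∃ (C : ECtx) (e₀ : Expr) (c : ℝ≥0) (μ : MDist Expr), e = C.fill e₀ ∧ Red P e₀ c μ

/-- The weighted reduction relation on multidistributions. -/
inductive MStep (P : Program) : MDist Expr → ℝ≥0 → MDist Expr → Prop
  | nf {e} : Terminal P e → MStep P {(1, e)} 0 {(1, e)}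
  | step {C : ECtx} {e c μ} : Red P e c μ →
      MStep P {(1, C.fill e)} c (μ.map fun x => (x.1, C.fill x.2))
  | conv {n : ℕ} {p : Fin n → ℝ≥0} {μ ν : Fin n → MDist Expr} {c : Fin n → ℝ≥0} :
      (∀ i, MStep P (μ i) (c i) (ν i)) → (∀ i, 0 < p i) → ∑ i, p i ≤ 1 →
      MStep P (∑ i, (μ i).scale (p i)) (∑ i, p i * c i) (∑ i, (ν i).scale (p i))

open Classical in
/-- The subdistribution on values induced by a multidistribution on expressions. -/
def valueDist (μ : MDist Expr) (v : Value) : ℝ≥0∞ :=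
  ((μ.filter fun x => x.2.toValue = some v).map fun x => (x.1 : ℝ≥0∞)).sum

/-- `e` evaluates to the subdistribution `μ` of values with (possibly infinite) total cost `c`:
there is a finite (`N < ⊤`) or infinite (`N = ⊤`) reduction sequence from `{e¹}` whose costs sum
up to `c` and whose restrictions to values converge to `μ`. -/
def Evaluates (P : Program) (e : Expr) (c : ℝ≥0∞) (μ : Value → ℝ≥0∞) : Prop :=
  ∃ (N : ℕ∞) (ν : ℕ → MDist Expr) (w : ℕ → ℝ≥0), ν 0 = {(1, e)} ∧
    (∀ n : ℕ, (n : ℕ∞) < N → MStep P (ν n) (w n) (ν (n + 1))) ∧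
    (∀ n : ℕ, N ≤ (n : ℕ∞) → w n = 0 ∧ ν (n + 1) = ν n) ∧
    c = ∑' n, (w n : ℝ≥0∞) ∧
    ∀ v, Filter.Tendsto (fun n => valueDist (ν n) v) Filter.atTop (𝓝 (μ v))

/-- The expected value of `f ≥ 0` with respect to a subdistribution of values. -/
def expect (μ : Value → ℝ≥0∞) (f : Value → ℝ) : ℝ≥0∞ := ∑' v, μ v * ENNReal.ofReal (f v)

/-! ### Potentials are non-negative -/

theorem Tree.one_le_size (t : Tree) : 1 ≤ t.size := by
  induction t with
  | leaf => simp [Tree.size]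
  | node l b r hl hr => simp only [Tree.size]; omega

theorem Tree.rk_nonneg (t : Tree) : 0 ≤ t.rk := by
  induction t with
  | leaf => simp [Tree.rk]
  | node l b r hl hr =>
    have h : ∀ u : Tree, 0 ≤ Real.logb 2 (u.size : ℝ) := fun u =>
      Real.logb_nonneg (by norm_num) (by exact_mod_cast u.one_le_size)
    simp only [Tree.rk]
    linarith [h l, h r]

theorem Annot.pot_nonneg {V : Type} {S : Set V} {Q : Annot V} (hQ : Q.On S) (t : V → Tree) :
    0 ≤ Q.pot t := by
  unfold Annot.pot
  refine add_nonneg (Finset.sum_nonneg fun x _ => ?_) (Finset.sum_nonneg fun i hi => ?_)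
  · exact mul_nonneg (NNReal.coe_nonneg _) (Tree.rk_nonneg _)
  · refine mul_nonneg (NNReal.coe_nonneg _) ?_
    have h1 : Annot.weight i.1 ≤ i.1.sum fun x n => (n : ℤ) * ((t x).size : ℤ) := by
      refine Finset.sum_le_sum fun x _ => ?_
      have := (t x).one_le_size
      nlinarith [Int.natCast_nonneg (i.1 x), (by exact_mod_cast this : (1 : ℤ) ≤ (t x).size)]
    have h2 := (hQ.2 i hi).2
    unfold Annot.logFun
    rcases (by omega : ((i.1.sum fun x n => (n : ℤ) * ((t x).size : ℤ)) + i.2) = 0 ∨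
      1 ≤ ((i.1.sum fun x n => (n : ℤ) * ((t x).size : ℤ)) + i.2)) with h | h
    · rw [h]; simp
    · exact Real.logb_nonneg (by norm_num) (by exact_mod_cast h)

end ProbAmort

end

open ProbAmort

/-! Evaluation is replaced by its finite approximations. `wp P m n f e` is a supremum over the
resolutions of nondeterminism: the expected value of `f` on the values reached within `n` steps,
plus the costs observed in the mode `m`. In the mode `cfnd`, probabilistic branching is resolved by
the supremum as well. Stuck and unfinished runs receive no payoff. The invariant `Sound` bounds `wp`
by the potential of the context, with `post` as payoff. As `post` is infinite on values of the wrong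
type, type preservation needs no separate proof: a bound to be shown for such a value is trivial.

Two inductions are nested in `Typed.sound`: on the number of steps, and for each of them on the
typing derivation. Only a call reduces to an expression whose typing is not a premise, and unfolding
it uses up a step. The summand `K • Q` of the application rule is covered by the subadditivity of
`wp` (`wp_add_mul_le`): the costs are already counted in the first summand, so the second one may be
cost-free.

The hard rule is the let rule for trees. By `wp_letIn_le`, a let is bounded by nested `wp`. The
potential of the context splits into a part paid to `e₁`, a part about `Δ` alone, and mixed terms
`log (a·t + b·u + c)`. The latter have to pay for terms `log (b·u + d|v| + e)` in which `v` is the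
result of `e₁`. Typing `e₁` says nothing about sums of `|v|` with sizes of other trees. The side
typings give `κ log (d|v| + max e 0) ≤ ∑ w log (a·t + c)`, in the mode `cfnd` and hence for every
reachable `v`, not just on average. The inequality `mul_logb_add_le` carries this through the shift
of all arguments by `b·u - max (-e) 0`; `LetTreeConstraints.pot_le` collects the outcome. What `e₁`
does not consume passes it as a constant, since the total mass never exceeds one
(`wp_add_const_le`).

Finally, along a given reduction sequence, the costs so far plus the expected payoff on the values
so far are below some `wp`; `Evaluates.le_of_wp_le` passes to the limit. -/

namespace ProbAmort

/-! ### Linear combinations of tree sizes -/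

namespace Annot

variable {V W : Type}

/-- The linear combination `∑ x, a x * |t x|`. -/
noncomputable def wsum (a : V →₀ ℕ) (t : V → Tree) : ℤ :=
  a.sum fun x n => (n : ℤ) * ((t x).size : ℤ)

noncomputable def rkPot (r : V →₀ ℝ≥0) (t : V → Tree) : ℝ := r.sum fun x q => (q : ℝ) * (t x).rk

noncomputable def lgPot (L : (V →₀ ℕ) × ℤ →₀ ℝ≥0) (t : V → Tree) : ℝ :=
  L.sum fun i q => (q : ℝ) * logFun i t

theorem pot_eq (Q : Annot V) (t : V → Tree) : Q.pot t = rkPot Q.rk t + lgPot Q.lg t := rfl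

theorem logFun_eq (i : (V →₀ ℕ) × ℤ) (t : V → Tree) :
    logFun i t = Real.logb 2 ((wsum i.1 t + i.2 : ℤ) : ℝ) := rfl

@[simp] theorem wsum_zero (t : V → Tree) : wsum 0 t = 0 := Finsupp.sum_zero_index

theorem wsum_add (a b : V →₀ ℕ) (t : V → Tree) : wsum (a + b) t = wsum a t + wsum b t := by
  unfold wsum
  classical
  exact Finsupp.sum_add_index' (by simp) (by intros; push_cast; ring)

@[simp] theorem wsum_single (x : V) (n : ℕ) (t : V → Tree) :
    wsum (Finsupp.single x n) t = n * (t x).size := by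
  simp [wsum]

theorem wsum_congr {a : V →₀ ℕ} {t u : V → Tree} (h : ∀ x ∈ a.support, t x = u x) :
    wsum a t = wsum a u :=
  Finset.sum_congr rfl fun x hx => by simp only [h x hx]

theorem wsum_mapDomain (f : V → W) (a : V →₀ ℕ) (t : W → Tree) :
    wsum (a.mapDomain f) t = wsum a (t ∘ f) := by
  unfold wsum
  rw [Finsupp.sum_mapDomain_index (by simp) (by intros; push_cast; ring)]
  rfl

theorem weight_le_wsum (a : V →₀ ℕ) (t : V → Tree) : weight a ≤ wsum a t := by
  refine Finset.sum_le_sum fun x _ => ?_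
  have h := (t x).one_le_size
  nlinarith [Int.natCast_nonneg (a x), (by exact_mod_cast h : (1 : ℤ) ≤ (t x).size)]

theorem wsum_nonneg (a : V →₀ ℕ) (t : V → Tree) : 0 ≤ wsum a t :=
  Finset.sum_nonneg fun _ _ => by positivity

theorem wsum_erase_add (a : V →₀ ℕ) (x : V) (t : V → Tree) :
    wsum a t = wsum (a.erase x) t + a x * (t x).size := by
  conv_lhs => rw [← Finsupp.erase_add_single x a]
  rw [wsum_add, wsum_single]

theorem logb_intCast_nonneg {z : ℤ} (hz : 0 ≤ z) : 0 ≤ Real.logb 2 (z : ℝ) := by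
  rcases hz.eq_or_lt with h | h
  · simp [← h]
  · exact Real.logb_nonneg (by norm_num) (by exact_mod_cast h)

theorem logFun_nonneg {i : (V →₀ ℕ) × ℤ} (h : 0 ≤ weight i.1 + i.2) (t : V → Tree) :
    0 ≤ logFun i t := by
  rw [logFun_eq]
  exact logb_intCast_nonneg (by have := weight_le_wsum i.1 t; omega)

theorem logFun_congr {i : (V →₀ ℕ) × ℤ} {j : (W →₀ ℕ) × ℤ} {t : V → Tree} {u : W → Tree}
    (h : wsum i.1 t + i.2 = wsum j.1 u + j.2) : logFun i t = logFun j u := by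
  rw [logFun_eq, logFun_eq, h]

/-! ### Linearity of potentials -/

@[simp] theorem rkPot_zero (t : V → Tree) : rkPot 0 t = 0 := Finsupp.sum_zero_index

@[simp] theorem lgPot_zero (t : V → Tree) : lgPot 0 t = 0 := Finsupp.sum_zero_index

theorem rkPot_add (r s : V →₀ ℝ≥0) (t : V → Tree) : rkPot (r + s) t = rkPot r t + rkPot s t := by
  classical
  exact Finsupp.sum_add_index' (by simp) (by intros; push_cast; ring)

theorem lgPot_add (L M : (V →₀ ℕ) × ℤ →₀ ℝ≥0) (t : V → Tree) :
    lgPot (L + M) t = lgPot L t + lgPot M t := by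
  classical
  exact Finsupp.sum_add_index' (by simp) (by intros; push_cast; ring)

theorem lgPot_finsetSum {ι : Type*} (I : Finset ι) (L : ι → (V →₀ ℕ) × ℤ →₀ ℝ≥0) (t : V → Tree) :
    lgPot (∑ j ∈ I, L j) t = ∑ j ∈ I, lgPot (L j) t := by
  classical
  induction I using Finset.induction_on with
  | empty => simp
  | insert j I hj ih => rw [Finset.sum_insert hj, Finset.sum_insert hj, lgPot_add, ih]

@[simp] theorem rkPot_single (x : V) (q : ℝ≥0) (t : V → Tree) :
    rkPot (Finsupp.single x q) t = q * (t x).rk := by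
  simp [rkPot]

@[simp] theorem lgPot_single (i : (V →₀ ℕ) × ℤ) (q : ℝ≥0) (t : V → Tree) :
    lgPot (Finsupp.single i q) t = q * logFun i t := by
  simp [lgPot]

theorem pot_add (P Q : Annot V) (t : V → Tree) : (P + Q).pot t = P.pot t + Q.pot t := by
  rw [pot_eq, pot_eq, pot_eq]
  change rkPot (P.rk + Q.rk) t + lgPot (P.lg + Q.lg) t = _
  rw [rkPot_add, lgPot_add]; ring

theorem pot_smul (K : ℝ≥0) (Q : Annot V) (t : V → Tree) : (K • Q).pot t = K * Q.pot t := by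
  change (K • Q.rk).sum (fun x q => (q : ℝ) * (t x).rk) +
    (K • Q.lg).sum (fun i q => (q : ℝ) * logFun i t) = K * (Q.rk.sum _ + Q.lg.sum _)
  rw [Finsupp.sum_smul_index (by simp), Finsupp.sum_smul_index (by simp), mul_add,
    Finsupp.mul_sum, Finsupp.mul_sum]
  congr 1 <;> refine Finsupp.sum_congr fun i _ => ?_ <;> push_cast <;> ring

theorem logFun_zero_two (t : V → Tree) : logFun ((0 : V →₀ ℕ), 2) t = 1 := by
  rw [logFun_eq]; simp

theorem pot_addConst (Q : Annot V) (K : ℝ≥0) (t : V → Tree) :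
    (Q.addConst K).pot t = Q.pot t + K := by
  rw [pot_eq, pot_eq]
  change rkPot Q.rk t + lgPot (Q.lg + Finsupp.single (0, 2) K) t = _
  rw [lgPot_add, lgPot_single, logFun_zero_two]; ring

/-- Coefficients that collide under `f` are added up, and the logarithms they multiply agree. Rules
that collect coefficients are thereby reduced to comparing the arguments of logarithms. -/
theorem lgPot_mapDomain {f : (V →₀ ℕ) × ℤ → (W →₀ ℕ) × ℤ} {L : (V →₀ ℕ) × ℤ →₀ ℝ≥0}
    {t : V → Tree} {u : W → Tree} (h : ∀ i ∈ L.support, logFun (f i) u = logFun i t) :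
    lgPot (L.mapDomain f) u = lgPot L t := by
  unfold lgPot
  rw [Finsupp.sum_mapDomain_index (by simp) (by intros; push_cast; ring)]
  exact Finset.sum_congr rfl fun i hi => by simp only [h i hi]

theorem rkPot_congr {r : V →₀ ℝ≥0} {t u : V → Tree} (h : ∀ x ∈ r.support, t x = u x) :
    rkPot r t = rkPot r u :=
  Finset.sum_congr rfl fun x hx => by simp only [h x hx]

theorem lgPot_congr {L : (V →₀ ℕ) × ℤ →₀ ℝ≥0} {t u : V → Tree}
    (h : ∀ i ∈ L.support, ∀ x ∈ i.1.support, t x = u x) : lgPot L t = lgPot L u :=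
  Finset.sum_congr rfl fun i hi => by
    simp only [logFun_congr (congrArg (· + i.2) (wsum_congr (h i hi)))]

theorem pot_congr {Q : Annot V} {S : Set V} (hQ : Q.On S) {t u : V → Tree}
    (h : ∀ x ∈ S, t x = u x) : Q.pot t = Q.pot u := by
  rw [pot_eq, pot_eq, rkPot_congr fun x hx => h x (hQ.1 hx),
    lgPot_congr fun i hi x hx => h x ((hQ.2 i hi).1 hx)]

theorem pot_rename (f : V → W) (Q : Annot V) (t : W → Tree) :
    (Q.rename f).pot t = Q.pot (t ∘ f) := by
  rw [pot_eq, pot_eq]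
  congr 1
  · change rkPot (Q.rk.mapDomain f) t = _
    unfold rkPot
    rw [Finsupp.sum_mapDomain_index (by simp) (by intros; push_cast; ring)]
    rfl
  · exact lgPot_mapDomain fun i _ => logFun_congr (by rw [wsum_mapDomain])

/-! ### Monotonicity of potentials -/

theorem rkPot_mono {r s : V →₀ ℝ≥0} (h : r ≤ s) (t : V → Tree) : rkPot r t ≤ rkPot s t := by
  have : s = r + (s - r) := (add_tsub_cancel_of_le h).symm
  rw [this, rkPot_add]
  exact le_add_of_nonneg_right
    (Finset.sum_nonneg fun x _ => mul_nonneg (NNReal.coe_nonneg _) (Tree.rk_nonneg _))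

theorem lgPot_nonneg {L : (V →₀ ℕ) × ℤ →₀ ℝ≥0} (h : ∀ i ∈ L.support, 0 ≤ weight i.1 + i.2)
    (t : V → Tree) : 0 ≤ lgPot L t :=
  Finset.sum_nonneg fun i hi => mul_nonneg (NNReal.coe_nonneg _) (logFun_nonneg (h i hi) t)

theorem lgPot_mono {L M : (V →₀ ℕ) × ℤ →₀ ℝ≥0} (h : L ≤ M)
    (hM : ∀ i ∈ M.support, 0 ≤ weight i.1 + i.2) (t : V → Tree) : lgPot L t ≤ lgPot M t := by
  have e : M = L + (M - L) := (add_tsub_cancel_of_le h).symm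
  rw [e, lgPot_add]
  refine le_add_of_nonneg_right (lgPot_nonneg (fun i hi => hM i ?_) t)
  rw [Finsupp.mem_support_iff] at hi ⊢
  intro h0
  apply hi
  simp [h0]

theorem rkPot_nonneg (r : V →₀ ℝ≥0) (t : V → Tree) : 0 ≤ rkPot r t :=
  Finset.sum_nonneg fun _ _ => mul_nonneg (NNReal.coe_nonneg _) (Tree.rk_nonneg _)

theorem filter_le (p : V → Prop) [DecidablePred p] (r : V →₀ ℝ≥0) : r.filter p ≤ r := by
  intro x
  rw [Finsupp.filter_apply]
  split_ifs <;> simp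

/-- No coefficient is spent twice; this is what allows a potential to be divided among
subexpressions. -/
theorem filter_add_filter_le {p q : V → Prop} [DecidablePred p] [DecidablePred q]
    (r : V →₀ ℝ≥0) (h : ∀ x, r x ≠ 0 → p x → ¬ q x) : r.filter p + r.filter q ≤ r := by
  intro x
  rw [Finsupp.add_apply, Finsupp.filter_apply, Finsupp.filter_apply]
  by_cases hx : r x = 0
  · simp [hx]
  · have := h x hx
    split_ifs <;> simp_all

theorem pot_restrict_le {Q : Annot V} {S : Set V} (hQ : Q.On S) (T : Set V) (t : V → Tree) :
    (Q.restrict T).pot t ≤ Q.pot t := by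
  classical
  exact add_le_add (rkPot_mono (filter_le _ _) t)
    (lgPot_mono (filter_le _ _) (fun i hi => (hQ.2 i hi).2) t)

/-! ### Potentials of leaves and nodes -/

/-- A leaf has rank and size one, so `q_x` becomes a constant, and the entry of the index vector at
`x` moves to the additive constant. -/
theorem pot_atLeaf {x : Var} {Q : Annot Var} {t : Var → Tree} (ht : t x = .leaf) :
    ((Q.atLeaf x).addConst (Q.rk x)).pot t = Q.pot t := by
  rw [pot_addConst, pot_eq, pot_eq]
  have h1 : rkPot Q.rk t = rkPot (Q.rk.erase x) t + Q.rk x := by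
    conv_lhs => rw [← Finsupp.erase_add_single x Q.rk]
    rw [rkPot_add, rkPot_single, ht]
    simp [Tree.rk]
  have h2 : lgPot (Q.atLeaf x).lg t = lgPot Q.lg t :=
    lgPot_mapDomain fun i _ => logFun_congr (by
      rw [wsum_erase_add i.1 x t, ht]; simp [Tree.size]; ring)
  rw [h1, h2]
  change rkPot (Q.rk.erase x) t + _ + _ = _
  ring

/-- The recursion for the rank yields two ranks and two logarithms, and `|t| = |l| + |r|` duplicates
the entry at `x`. Separate families `t` and `u` that need not agree at `x` permit `x₁ = x`, which
the node rule uses. -/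
theorem pot_atNode {x x₁ x₃ : Var} {Q : Annot Var} {S : Set Var} (hQ : Q.On S) {t u : Var → Tree}
    {b : Const} (hx : t x = .node (u x₁) b (u x₃)) (h : ∀ y ∈ S, y ≠ x → u y = t y) :
    (Q.atNode x x₁ x₃).pot u = Q.pot t := by
  rw [pot_eq, pot_eq]
  change rkPot (Q.rk.erase x + Finsupp.single x₁ (Q.rk x) + Finsupp.single x₃ (Q.rk x)) u +
    lgPot ((Q.lg.mapDomain fun i =>
      (i.1.erase x + Finsupp.single x₁ (i.1 x) + Finsupp.single x₃ (i.1 x), i.2)) +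
    Finsupp.single (Finsupp.single x₁ 1, 0) (Q.rk x) +
    Finsupp.single (Finsupp.single x₃ 1, 0) (Q.rk x)) u = _
  have h1 : rkPot Q.rk t = rkPot (Q.rk.erase x) u + Q.rk x * (t x).rk := by
    conv_lhs => rw [← Finsupp.erase_add_single x Q.rk]
    rw [rkPot_add, rkPot_single]
    congr 1
    refine rkPot_congr fun y hy => ?_
    rw [Finsupp.support_erase, Finset.mem_erase] at hy
    exact (h y (hQ.1 hy.2) hy.1).symm
  rw [lgPot_add, lgPot_add, lgPot_mapDomain (t := t), rkPot_add, rkPot_add, h1, hx]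
  · simp only [rkPot_single, lgPot_single, logFun_eq, wsum_single, Tree.rk]
    simp
    ring
  · intro i hi
    refine logFun_congr ?_
    rw [wsum_erase_add i.1 x t, hx, wsum_add, wsum_add, wsum_single, wsum_single]
    rw [wsum_congr (t := u) (u := t)]
    · simp only [Tree.size]; push_cast; ring
    · intro y hy
      rw [Finsupp.support_erase, Finset.mem_erase] at hy
      exact h y ((hQ.2 i hi).1 hy.2) hy.1

end Annot

open Annot

/-- The constants dropped from the input are worthless: for well-formed indices they are `log 0` and
`log 1`, both zero. -/
theorem pot_leafInput {Q' : Annot Unit} {S : Set Unit} (hQ : Q'.On S) (t : Var → Tree) :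
    ((leafInput Q').addConst (Q'.rk ())).pot t = valPot (.tree .leaf) Q' := by
  classical
  rw [pot_addConst, valPot, pot_eq, pot_eq]
  have h0 : rkPot Q'.rk (fun _ => Tree.leaf) = Q'.rk () := by
    rw [rkPot, Finsupp.sum_fintype _ _ (by simp)]
    simp [Tree.rk]
  have h1 : lgPot (leafInput Q').lg t =
      lgPot (Q'.lg.mapDomain fun i => ((0 : Var →₀ ℕ), (i.1 () : ℤ) + i.2)) t := by
    change lgPot (Finsupp.filter _ _) t = _
    conv_rhs => rw [← Finsupp.filter_add_filter_not (Q'.lg.mapDomain fun i =>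
      ((0 : Var →₀ ℕ), (i.1 () : ℤ) + i.2)) (fun i => 2 ≤ i.2)]
    rw [lgPot_add, left_eq_add]
    refine Finset.sum_eq_zero fun i hi => ?_
    rw [Finsupp.support_filter, Finset.mem_filter] at hi
    obtain ⟨j, hj, rfl⟩ := Finset.mem_image.mp (Finsupp.mapDomain_support hi.1)
    have h2 := (hQ.2 j hj).2
    have h3 : weight j.1 = j.1 () := by simp [weight, Finsupp.sum_fintype]
    rw [h3] at h2
    -- The lower bound is well-formedness of the index, the upper bound the failure of the filter.
    have h4 : (j.1 () : ℤ) + j.2 = 0 ∨ (j.1 () : ℤ) + j.2 = 1 := by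
      have := hi.2
      simp only at this
      omega
    have h5 : logFun ((0 : Var →₀ ℕ), (j.1 () : ℤ) + j.2) t = 0 := by
      rw [logFun_eq]
      rcases h4 with h4 | h4 <;> simp [h4]
    simp only [h5, mul_zero]
  have h2 : lgPot (Q'.lg.mapDomain fun i => ((0 : Var →₀ ℕ), (i.1 () : ℤ) + i.2)) t =
      lgPot Q'.lg (fun _ => Tree.leaf) :=
    lgPot_mapDomain fun i _ => logFun_congr (by
      simp [wsum, Finsupp.sum_fintype, Tree.size])
  rw [h1, h2]
  simp only [Value.tree?, Option.getD_some]
  rw [h0]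
  change rkPot 0 t + _ + _ = _
  rw [rkPot_zero]; ring

/-! ### The shift inequality for logarithms -/

/-- If the weighted sum of the `log (u i)` dominates `κ * log V`, and all weights are at least `κ`,
then this is preserved when all arguments are shifted by `y ≥ 0`. -/
theorem mul_logb_add_le {ι : Type*} {s : Finset ι} (hs : s.Nonempty) {w u : ι → ℝ} {κ V y : ℝ}
    (hκ : 0 < κ) (hV : 0 < V) (hy : 0 ≤ y) (hw : ∀ i ∈ s, κ ≤ w i) (hu : ∀ i ∈ s, 1 ≤ u i)
    (h : κ * Real.logb 2 V ≤ ∑ i ∈ s, w i * Real.logb 2 (u i)) :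
    κ * Real.logb 2 (V + y) ≤ ∑ i ∈ s, w i * Real.logb 2 (u i + y) := by
  classical
  obtain ⟨k, hk⟩ := hs
  set T := ∑ i ∈ s, w i * Real.logb 2 (u i) with hT
  have hlog : ∀ i ∈ s, 0 ≤ Real.logb 2 (u i) := fun i hi =>
    Real.logb_nonneg (by norm_num) (hu i hi)
  have hinc : ∀ i ∈ s, Real.logb 2 (u i) ≤ Real.logb 2 (u i + y) := fun i hi =>
    Real.logb_le_logb_of_le (by norm_num) (by linarith [hu i hi]) (by linarith)
  have hk1 := hu k hk
  have hTk : κ * Real.logb 2 (u k) ≤ T :=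
    (mul_le_mul_of_nonneg_right (hw k hk) (hlog k hk)).trans
      (Finset.single_le_sum (f := fun i => w i * Real.logb 2 (u i))
        (fun i hi => mul_nonneg (hκ.le.trans (hw i hi)) (hlog i hi)) hk)
  -- All terms grow under the shift, but only the growth of one of them is needed.
  have hsum : T + κ * (Real.logb 2 (u k + y) - Real.logb 2 (u k)) ≤
      ∑ i ∈ s, w i * Real.logb 2 (u i + y) := by
    have h1 : κ * (Real.logb 2 (u k + y) - Real.logb 2 (u k)) ≤
        ∑ i ∈ s, w i * (Real.logb 2 (u i + y) - Real.logb 2 (u i)) :=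
      (mul_le_mul_of_nonneg_right (hw k hk) (sub_nonneg.mpr (hinc k hk))).trans
        (Finset.single_le_sum
          (f := fun i => w i * (Real.logb 2 (u i + y) - Real.logb 2 (u i)))
          (fun i hi => mul_nonneg (hκ.le.trans (hw i hi)) (sub_nonneg.mpr (hinc i hi))) hk)
    simp only [mul_sub, Finset.sum_sub_distrib] at h1 ⊢
    linarith
  refine le_trans ?_ hsum
  -- `U` is the number with `κ log U = T`. It dominates `V` by assumption, and `u k` because the
  -- `k`-th term alone is at most `T`.
  set U : ℝ := 2 ^ (T / κ) with hU
  have hUpos : 0 < U := by positivity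
  have hlogU : Real.logb 2 U = T / κ := Real.logb_rpow (by norm_num) (by norm_num)
  have hVU : V ≤ U := by
    rw [← Real.logb_le_logb (b := 2) (by norm_num) hV hUpos, hlogU, le_div_iff₀ hκ]
    linarith
  have hukU : u k ≤ U := by
    rw [← Real.logb_le_logb (b := 2) (by norm_num) (by linarith) hUpos, hlogU, le_div_iff₀ hκ]
    linarith
  have hTU : T = κ * Real.logb 2 U := by rw [hlogU]; field_simp
  rw [hTU, ← mul_add]
  refine mul_le_mul_of_nonneg_left ?_ hκ.le
  rw [← Real.logb_div (by linarith) (by linarith),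
    ← Real.logb_mul hUpos.ne' (div_pos (by linarith) (by linarith)).ne']
  refine Real.logb_le_logb_of_le (by norm_num) (by linarith) ?_
  -- What remains is `(V + y) * u k ≤ U * (u k + y)`, which is `V ≤ U` times `u k` plus `u k ≤ U`
  -- times `y`.
  rw [mul_div_assoc', le_div_iff₀ (by linarith)]
  nlinarith [mul_le_mul_of_nonneg_right hVU (by linarith : 0 ≤ u k),
    mul_le_mul_of_nonneg_right hukU hy]

/-! ### Splitting a potential between the two parts of a let -/

namespace Annot

theorem filter_filter {V : Type} (p q : V → Prop) [DecidablePred p] [DecidablePred q]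
    [DecidablePred fun x => p x ∧ q x] (r : V →₀ ℝ≥0) :
    (r.filter p).filter q = r.filter fun x => p x ∧ q x := by
  ext1 x
  simp only [Finsupp.filter_apply]
  split_ifs <;> simp_all

open Classical in
/-- The potential of the trees in `D`, without the constants. -/
noncomputable def outerPot (D : Set Var) (Q : Annot Var) (t : Var → Tree) : ℝ :=
  rkPot (Q.rk.filter (· ∈ D)) t +
    lgPot ((Q.lg.filter fun i => ↑i.1.support ⊆ D).filter fun i => i.1 ≠ 0) t

theorem add_single_erase {a : Var →₀ ℕ} {x : Var} (hx : a x = 0) (n : ℕ) :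
    (a + Finsupp.single x n).erase x = a := by
  ext y
  by_cases h : y = x
  · subst h; simp [hx]
  · simp [Finsupp.erase_ne h]

theorem eq_zero_of_support_subset {a : Var →₀ ℕ} {D : Set Var} {x : Var}
    (ha : ↑a.support ⊆ D) (hx : x ∉ D) : a x = 0 := by
  by_contra h
  exact hx (ha (Finsupp.mem_support_iff.mpr h))

/-- The constants belong to the restriction to `G` and are left out of the outer part, so the two
parts use different coefficients of `Q`. -/
theorem restrict_pot_add_outerPot_le {Q : Annot Var} {S G D : Set Var} (hQ : Q.On S)
    (hGD : Disjoint G D) (t : Var → Tree) :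
    (Q.restrict G).pot t + outerPot D Q t ≤ Q.pot t := by
  classical
  have h1 : Q.rk.filter (· ∈ G) + Q.rk.filter (· ∈ D) ≤ Q.rk :=
    filter_add_filter_le _ fun x _ hx hx' => Set.disjoint_left.mp hGD hx hx'
  have h2 : (Q.lg.filter fun i => ↑i.1.support ⊆ G) +
      ((Q.lg.filter fun i => ↑i.1.support ⊆ D).filter fun i => i.1 ≠ 0) ≤ Q.lg := by
    rw [filter_filter]
    refine filter_add_filter_le _ fun i _ hi hi' => hi'.2 ?_
    rw [← Finsupp.support_eq_empty, ← Finset.coe_eq_empty]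
    exact Set.subset_empty_iff.mp fun y hy => Set.disjoint_left.mp hGD (hi hy) (hi'.1 hy)
  have h3 := rkPot_mono h1 t
  have h4 := lgPot_mono h2 (fun i hi => (hQ.2 i hi).2) t
  rw [rkPot_add] at h3
  rw [lgPot_add] at h4
  have h5 : (Q.restrict G).pot t = rkPot (Q.rk.filter (· ∈ G)) t +
      lgPot (Q.lg.filter fun i => ↑i.1.support ⊆ G) t := rfl
  rw [h5, pot_eq Q, outerPot]
  linarith

theorem outerPot_congr {Q : Annot Var} {D : Set Var} {t u : Var → Tree}
    (h : ∀ y ∈ D, t y = u y) : outerPot D Q t = outerPot D Q u := by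
  classical
  unfold outerPot
  congr 1
  · refine rkPot_congr fun x hx => ?_
    rw [Finsupp.support_filter, Finset.mem_filter] at hx
    exact h x hx.2
  · refine lgPot_congr fun i hi x hx => ?_
    rw [Finsupp.support_filter, Finset.mem_filter, Finsupp.support_filter, Finset.mem_filter] at hi
    exact h x (hi.1.2 hx)

end Annot

/-- The body only inherits the constants of `P'` and the part of `Q` about `Δ`. The mixed terms of
`Q` and the other coefficients of `P'` are thrown away, at no risk since they contribute
non-negatively. -/
theorem pot_letBaseAnnot_le {Γ Δ : Ctx} {Q : Annot Var} {P' : Annot Unit} {S : Set Var}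
    {T : Set Unit} (hQ : Q.On S) (hP' : P'.On T) (hΓΔ : Disjoint Γ.trees Δ.trees)
    {t u : Var → Tree} (h : ∀ y ∈ Δ.trees, u y = t y) (w : Unit → Tree) :
    (letBaseAnnot Δ Q P').pot u ≤ P'.pot w + (Q.pot t - (Q.restrict Γ.trees).pot t) := by
  classical
  have h1 := restrict_pot_add_outerPot_le hQ hΓΔ t
  rw [← outerPot_congr h] at h1
  have h2 : (letBaseAnnot Δ Q P').pot u = outerPot Δ.trees Q u +
      lgPot ((P'.lg.filter fun i => i.1 = 0).mapDomain fun i => ((0 : Var →₀ ℕ), i.2)) u := by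
    rw [pot_eq, outerPot, add_assoc, ← lgPot_add]
    rfl
  have h3 : lgPot ((P'.lg.filter fun i => i.1 = 0).mapDomain fun i => ((0 : Var →₀ ℕ), i.2)) u =
      lgPot (P'.lg.filter fun i => i.1 = 0) w := by
    refine lgPot_mapDomain fun i hi => logFun_congr ?_
    rw [Finsupp.support_filter, Finset.mem_filter] at hi
    rw [hi.2]; simp
  have h4 : lgPot (P'.lg.filter fun i => i.1 = 0) w ≤ lgPot P'.lg w :=
    lgPot_mono (filter_le _ _) (fun i hi => (hP'.2 i hi).2) w
  have h5 := rkPot_nonneg P'.rk w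
  rw [h2, h3, pot_eq P']
  linarith

/-! ### The constraints of the let rule for trees -/

namespace LetTreeConstraints

variable {Γ Δ : Ctx} {x : Var} {Q : Annot Var} {P' : Annot Unit} {R : Annot Var}
  {I : Finset ((Var →₀ ℕ) × ℕ × ℤ)} {p : (Var →₀ ℕ) × ℕ × ℤ → Annot Var}
  {κ : (Var →₀ ℕ) × ℕ × ℤ → ℝ≥0}

-- An index of `R` has the form `b + d·x` with `b` not involving `x`. The case `b = 0` is governed
-- by `P'`, the case `b ≠ 0`, `d = 0` by `Q`, and the remaining one by `κ`. The three summands live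
-- on disjoint sets of indices.
open Classical in
theorem lg_eq (hc : LetTreeConstraints Γ Δ x Q P' R I p κ) (hx : x ∉ Δ.trees)
    (hR : R.On (insert x Δ.trees)) :
    R.lg = (P'.lg.mapDomain fun i => (Finsupp.single x (i.1 ()), i.2)) +
      ((Q.lg.filter fun i => ↑i.1.support ⊆ Δ.trees).filter fun i => i.1 ≠ 0) +
      ∑ j ∈ I, Finsupp.single (j.1 + Finsupp.single x j.2.1, j.2.2) (κ j) := by
  ext1 i
  obtain ⟨w, c⟩ := i
  obtain ⟨b, d, hbx, rfl⟩ : ∃ b d, b x = 0 ∧ w = b + Finsupp.single x d :=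
    ⟨w.erase x, w x, by simp, (Finsupp.erase_add_single x w).symm⟩
  have hinj : Function.Injective
      fun i : (Unit →₀ ℕ) × ℤ => ((Finsupp.single x (i.1 ()) : Var →₀ ℕ), i.2) := by
    rintro ⟨a, m⟩ ⟨a', m'⟩ h
    simp only [Prod.mk.injEq] at h
    refine Prod.ext (Finsupp.ext fun _ => ?_) h.2
    exact Finsupp.single_injective x h.1
  have hmap : b ≠ 0 → (P'.lg.mapDomain
      fun i => ((Finsupp.single x (i.1 ()) : Var →₀ ℕ), i.2)) (b + Finsupp.single x d, c) = 0 := by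
    intro hb
    refine Finsupp.mapDomain_of_notMem_range _ _ ?_
    rintro ⟨i, hi⟩
    simp only [Prod.mk.injEq] at hi
    apply hb
    rw [← add_single_erase hbx d, ← hi.1]
    simp
  have hfilter : d ≠ 0 → ((Q.lg.filter fun i => ↑i.1.support ⊆ Δ.trees).filter fun i => i.1 ≠ 0)
      (b + Finsupp.single x d, c) = 0 := by
    intro hd
    rw [filter_filter, Finsupp.filter_apply_neg]
    rintro ⟨h, -⟩
    have := eq_zero_of_support_subset h hx
    simp [hbx] at this
    exact hd this
  -- The indices in `I` do not involve `x`, so `(b, d, e)` can be read off from `b + d·x` and `e`.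
  have hkey : ∀ j ∈ I, (j.1 + Finsupp.single x j.2.1, j.2.2) = (b + Finsupp.single x d, c) →
      j = (b, d, c) := by
    intro j hj h
    simp only [Prod.mk.injEq] at h
    have hjx := eq_zero_of_support_subset (hc.index j hj).2.1 hx
    have h1 : j.1 = b := by
      rw [← add_single_erase hjx j.2.1, h.1, add_single_erase hbx]
    have h2 : j.2.1 = d := by
      have := DFunLike.congr_fun h.1 x
      simpa [hjx, hbx] using this
    exact Prod.ext h1 (Prod.ext h2 h.2)
  have hsum : (b, d, c) ∉ I → (∑ j ∈ I, Finsupp.single (j.1 + Finsupp.single x j.2.1, j.2.2) (κ j))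
      (b + Finsupp.single x d, c) = 0 := by
    intro hI
    rw [Finsupp.finsetSum_apply]
    refine Finset.sum_eq_zero fun j hj => Finsupp.single_eq_of_ne fun h => hI ?_
    rw [← hkey j hj h.symm]; exact hj
  rw [Finsupp.add_apply, Finsupp.add_apply]
  by_cases hb : b = 0
  · subst hb
    have h1 : (0, d, c) ∉ I := fun h => (hc.index _ h).1 rfl
    have h2 : ((Q.lg.filter fun i => ↑i.1.support ⊆ Δ.trees).filter fun i => i.1 ≠ 0)
      (0 + Finsupp.single x d, c) = 0 := by
      by_cases hd : d = 0
      · subst hd; rw [Finsupp.filter_apply_neg]; simp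
      · exact hfilter hd
    rw [hsum h1, h2, add_zero, add_zero, zero_add, hc.lg_new]
    have h3 := Finsupp.mapDomain_apply hinj P'.lg (Finsupp.single () d, c)
    simpa using h3.symm
  · rw [hmap hb, zero_add]
    by_cases hbD : ↑b.support ⊆ Δ.trees
    · by_cases hd : d = 0
      · subst hd
        rw [hsum fun h => (hc.index _ h).2.2 rfl, add_zero, filter_filter]
        rw [Finsupp.single_zero, add_zero, hc.lg_old b c hb hbD, Finsupp.filter_apply_pos]
        exact ⟨hbD, hb⟩
      · rw [hfilter hd, zero_add]
        by_cases hI : (b, d, c) ∈ I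
        · rw [Finsupp.finsetSum_apply, Finset.sum_eq_single (b, d, c)]
          · rw [Finsupp.single_eq_same]; exact hc.lg_out _ hI
          · intro j hj hne
            exact Finsupp.single_eq_of_ne fun h => hne (hkey j hj h.symm)
          · exact fun h => absurd hI h
        · rw [hsum hI]; exact hc.lg_zero b d c hb hbD hd hI
    -- Outside `Δ` and `x` no constraint mentions `R`; there it vanishes because it is an annotation
    -- for the context of the body.
    · rw [hsum fun h => hbD (hc.index _ h).2.1, add_zero, filter_filter,
        Finsupp.filter_apply_neg]
      · by_contra h
        have h1 := (hR.2 _ (Finsupp.mem_support_iff.mpr h)).1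
        apply hbD
        intro y hy
        have hyx : y ≠ x := by
          rintro rfl
          exact (Finsupp.mem_support_iff.mp (Finset.mem_coe.mp hy)) hbx
        have : y ∈ (b + Finsupp.single x d).support := by
          simp only [Finset.mem_coe, Finsupp.mem_support_iff] at hy ⊢
          simp [hy]
        exact (h1 this).resolve_left hyx
      · rintro ⟨h, -⟩
        apply hbD
        intro y hy
        refine h ?_
        simp only [Finset.mem_coe, Finsupp.mem_support_iff] at hy ⊢
        simp [hy]

theorem rk_eq (hc : LetTreeConstraints Γ Δ x Q P' R I p κ) (hx : x ∉ Δ.trees)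
    (hR : R.On (insert x Δ.trees)) [DecidablePred (· ∈ Δ.trees)] :
    R.rk = Q.rk.filter (· ∈ Δ.trees) + Finsupp.single x (P'.rk ()) := by
  ext1 y
  rw [Finsupp.add_apply]
  by_cases hy : y = x
  · subst hy
    rw [Finsupp.filter_apply_neg _ _ hx, hc.rk_new]; simp
  · rw [Finsupp.single_eq_of_ne hy, add_zero]
    by_cases hD : y ∈ Δ.trees
    · rw [Finsupp.filter_apply_pos _ _ hD, hc.rk_old y hD]
    · rw [Finsupp.filter_apply_neg _ _ hD]
      by_contra h
      exact (hR.1 (Finsupp.mem_support_iff.mpr h)).elim hy hD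

theorem pot_eq (hc : LetTreeConstraints Γ Δ x Q P' R I p κ) (hx : x ∉ Δ.trees)
    (hR : R.On (insert x Δ.trees)) (u : Var → Tree) :
    R.pot u = P'.pot (fun _ => u x) + outerPot Δ.trees Q u +
      ∑ j ∈ I, κ j * logFun (j.1 + Finsupp.single x j.2.1, j.2.2) u := by
  classical
  rw [Annot.pot_eq, Annot.pot_eq, outerPot, hc.lg_eq hx hR, hc.rk_eq hx hR, rkPot_add, lgPot_add,
    lgPot_add, lgPot_finsetSum, lgPot_mapDomain (t := fun _ => u x)]
  · have h : rkPot P'.rk (fun _ => u x) = P'.rk () * (u x).rk := by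
      rw [rkPot, Finsupp.sum_fintype _ _ (by simp)]
      simp
    rw [h]
    simp only [lgPot_single, rkPot_single]
    ring
  · intro i _
    refine logFun_congr ?_
    simp [wsum, Finsupp.sum_fintype]

/-- The coefficients of `Q` that the side annotation `p j` accounts for. -/
noncomputable def mixed (p : (Var →₀ ℕ) × ℕ × ℤ → Annot Var) (j : (Var →₀ ℕ) × ℕ × ℤ) :
    (Var →₀ ℕ) × ℤ →₀ ℝ≥0 :=
  (p j).lg.mapDomain fun i => (i.1 + j.1, i.2 - max (-j.2.2) 0)

def IsMixed (Γ Δ : Ctx) (w : Var →₀ ℕ) : Prop :=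
  ∃ a b : Var →₀ ℕ, a ≠ 0 ∧ ↑a.support ⊆ Γ.trees ∧ b ≠ 0 ∧ ↑b.support ⊆ Δ.trees ∧ w = a + b

/-- A mixed index determines its two halves, so a side annotation contributes only to mixed indices
with its own `b`. -/
theorem add_eq_add_of_disjoint {G D : Set Var} (h : Disjoint G D) {a a' b b' : Var →₀ ℕ}
    (ha : ↑a.support ⊆ G) (ha' : ↑a'.support ⊆ G) (hb : ↑b.support ⊆ D) (hb' : ↑b'.support ⊆ D)
    (e : a + b = a' + b') : a = a' ∧ b = b' := by
  have key : ∀ y, a y = a' y ∧ b y = b' y := by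
    intro y
    have hy : a y + b y = a' y + b' y := DFunLike.congr_fun e y
    by_cases hG : y ∈ G
    · have hD := Set.disjoint_left.mp h hG
      rw [eq_zero_of_support_subset hb hD, eq_zero_of_support_subset hb' hD] at hy ⊢
      simpa using hy
    · rw [eq_zero_of_support_subset ha hG, eq_zero_of_support_subset ha' hG] at hy ⊢
      simpa using hy
  exact ⟨Finsupp.ext fun y => (key y).1, Finsupp.ext fun y => (key y).2⟩

-- Together the side annotations use up exactly the mixed coefficients of `Q`. They have no constant
-- terms, so each of their indices becomes genuinely mixed when `b` is added.
open Classical in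
theorem sum_mixed (hc : LetTreeConstraints Γ Δ x Q P' R I p κ) (hΓΔ : Disjoint Γ.trees Δ.trees)
    (hp : ∀ j ∈ I, (p j).On Γ.trees) :
    ∑ j ∈ I, mixed p j = Q.lg.filter fun i => IsMixed Γ Δ i.1 := by
  have hsupp : ∀ j ∈ I, ∀ i, mixed p j i ≠ 0 → ∃ k, (p j).lg k ≠ 0 ∧ k.1 ≠ 0 ∧
      ↑k.1.support ⊆ Γ.trees ∧ i = (k.1 + j.1, k.2 - max (-j.2.2) 0) := by
    intro j hj i hi
    obtain ⟨k, hk, rfl⟩ :=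
      Finset.mem_image.mp (Finsupp.mapDomain_support (Finsupp.mem_support_iff.mpr hi))
    have hk0 := Finsupp.mem_support_iff.mp hk
    refine ⟨k, hk0, ?_, ((hp j hj).2 k hk).1, rfl⟩
    intro h
    apply hk0
    rw [← hc.side_const j hj k.2, ← h]
  ext1 ⟨w, c⟩
  rw [Finsupp.finsetSum_apply]
  by_cases hw : IsMixed Γ Δ w
  · rw [Finsupp.filter_apply, if_pos hw]
    obtain ⟨a, b, ha, haΓ, hb, hbΔ, rfl⟩ := hw
    rw [hc.lg_mixed a b c ha haΓ hb hbΔ, Finset.sum_filter]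
    refine Finset.sum_congr rfl fun j hj => ?_
    by_cases h : j.1 = b
    · rw [if_pos h]
      have hinj : Function.Injective
          fun i : (Var →₀ ℕ) × ℤ => (i.1 + j.1, i.2 - max (-j.2.2) 0) := by
        rintro ⟨_, _⟩ ⟨_, _⟩ h
        simpa using h
      have := Finsupp.mapDomain_apply hinj (p j).lg (a, c + max (-j.2.2) 0)
      simp only [add_sub_cancel_right, h] at this
      rw [mixed, h]; exact this
    · rw [if_neg h]
      by_contra h0
      obtain ⟨k, -, -, hkΓ, hk⟩ := hsupp j hj _ h0
      rw [Prod.mk.injEq] at hk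
      exact h (add_eq_add_of_disjoint hΓΔ haΓ hkΓ hbΔ (hc.index j hj).2.1 hk.1).2.symm
  · rw [Finsupp.filter_apply, if_neg hw]
    refine Finset.sum_eq_zero fun j hj => ?_
    by_contra h0
    obtain ⟨k, -, hk0, hkΓ, hk⟩ := hsupp j hj _ h0
    rw [Prod.mk.injEq] at hk
    exact hw ⟨k.1, j.1, hk0, hkΓ, (hc.index j hj).1, (hc.index j hj).2.1, hk.1⟩

/-- Indices over `Γ` (constants included), nonzero indices over `Δ` and mixed indices exclude each
other, so the three parts can be paid from `Q` simultaneously. -/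
theorem pot_add_le (hc : LetTreeConstraints Γ Δ x Q P' R I p κ)
    (hΓΔ : Disjoint Γ.trees Δ.trees) (hp : ∀ j ∈ I, (p j).On Γ.trees) {S : Set Var}
    (hQ : Q.On S) (t : Var → Tree) :
    (Q.restrict Γ.trees).pot t + outerPot Δ.trees Q t + ∑ j ∈ I, lgPot (mixed p j) t ≤
      Q.pot t := by
  classical
  rw [← lgPot_finsetSum, hc.sum_mixed hΓΔ hp]
  have h0 : ∀ {w : Var →₀ ℕ}, ↑w.support ⊆ Γ.trees → ↑w.support ⊆ Δ.trees → w = 0 := by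
    intro w h1 h2
    rw [← Finsupp.support_eq_empty, ← Finset.coe_eq_empty]
    exact Set.subset_empty_iff.mp fun y hy => Set.disjoint_left.mp hΓΔ (h1 hy) (h2 hy)
  have h1 : Q.rk.filter (· ∈ Γ.trees) + Q.rk.filter (· ∈ Δ.trees) ≤ Q.rk :=
    filter_add_filter_le _ fun x _ hx hx' => Set.disjoint_left.mp hΓΔ hx hx'
  have h2 : (Q.lg.filter fun i => ↑i.1.support ⊆ Γ.trees) +
      ((Q.lg.filter fun i => ↑i.1.support ⊆ Δ.trees).filter fun i => i.1 ≠ 0) +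
      (Q.lg.filter fun i => IsMixed Γ Δ i.1) ≤ Q.lg := by
    have hmixed : ∀ {w : Var →₀ ℕ}, IsMixed Γ Δ w →
        ¬ ↑w.support ⊆ Γ.trees ∧ ¬ ↑w.support ⊆ Δ.trees := by
      rintro w ⟨a, b, ha, haΓ, hb, hbΔ, rfl⟩
      have hs : (a + b).support = a.support ∪ b.support := by
        ext y
        simp only [Finsupp.mem_support_iff, Finsupp.add_apply, Finset.mem_union]
        omega
      rw [hs]
      push_cast
      exact ⟨fun h => hb (h0 (Set.subset_union_right.trans h) hbΔ),
        fun h => ha (h0 haΓ (Set.subset_union_left.trans h))⟩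
    rw [filter_filter]
    intro i
    rw [Finsupp.add_apply, Finsupp.add_apply, Finsupp.filter_apply, Finsupp.filter_apply,
      Finsupp.filter_apply]
    by_cases hm : IsMixed Γ Δ i.1
    · rw [if_neg (hmixed hm).1, if_neg fun h => (hmixed hm).2 h.1, if_pos hm]; simp
    · rw [if_neg hm]
      by_cases hG : ↑i.1.support ⊆ Γ.trees
      · rw [if_pos hG, if_neg fun h => h.2 (h0 hG h.1)]; simp
      · rw [if_neg hG]; split_ifs <;> simp
  have h3 := rkPot_mono h1 t
  have h4 := lgPot_mono h2 (fun i hi => (hQ.2 i hi).2) t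
  rw [rkPot_add] at h3
  rw [lgPot_add, lgPot_add] at h4
  have h5 : (Q.restrict Γ.trees).pot t = rkPot (Q.rk.filter (· ∈ Γ.trees)) t +
      lgPot (Q.lg.filter fun i => ↑i.1.support ⊆ Γ.trees) t := rfl
  rw [h5, Annot.pot_eq Q, outerPot]
  linarith

/-- One application of `mul_logb_add_le` with `V = d|v| + max e 0` and shift `y = b·t - max (-e) 0`;
the constraints on the side annotation are its hypotheses. -/
theorem mul_logFun_le (hc : LetTreeConstraints Γ Δ x Q P' R I p κ)
    (hΓΔ : Disjoint Γ.trees Δ.trees) (hp : ∀ j ∈ I, (p j).On Γ.trees) {S : Set Var}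
    (hQ : Q.On S) {t u : Var → Tree} (htu : ∀ y ∈ Δ.trees, u y = t y)
    {j : (Var →₀ ℕ) × ℕ × ℤ} (hj : j ∈ I)
    (h : (sideOut j.2.1 j.2.2 (κ j)).pot (fun _ => u x) ≤ (p j).pot t) :
    κ j * logFun (j.1 + Finsupp.single x j.2.1, j.2.2) u ≤ lgPot (mixed p j) t := by
  classical
  obtain ⟨hj0, hjΔ, hd⟩ := hc.index j hj
  -- For `κ = 0` it remains to see that the mixed part is non-negative; its indices are well-formed
  -- since they occur in `Q`.
  rcases eq_or_ne (κ j) 0 with hκ | hκ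
  · rw [hκ]
    simp only [NNReal.coe_zero, zero_mul]
    refine lgPot_nonneg (fun i hi => (hQ.2 i ?_).2) t
    have h1 : mixed p j i ≤ ∑ k ∈ I, mixed p k i :=
      Finset.single_le_sum (f := fun k => mixed p k i) (fun _ _ => zero_le) hj
    rw [← Finsupp.finsetSum_apply, hc.sum_mixed hΓΔ hp] at h1
    rw [Finsupp.mem_support_iff] at hi ⊢
    intro h0
    apply hi
    refine le_antisymm (h1.trans ?_) zero_le
    rw [Finsupp.filter_apply]
    split_ifs <;> simp [h0]
  · have hκpos : (0 : ℝ) < κ j := by exact_mod_cast pos_iff_ne_zero.mpr hκ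
    have hmix : lgPot (mixed p j) t = ∑ i ∈ (p j).lg.support, ((p j).lg i : ℝ) *
        Real.logb 2 (((wsum i.1 t + i.2 : ℤ) : ℝ) +
          ((wsum j.1 t - max (-j.2.2) 0 : ℤ) : ℝ)) := by
      rw [mixed, lgPot, Finsupp.sum_mapDomain_index (by simp) (by intros; push_cast; ring)]
      refine Finset.sum_congr rfl fun i _ => ?_
      simp only [logFun_eq, wsum_add, ← Int.cast_add]
      congr 3
      ring
    have hout : (sideOut j.2.1 j.2.2 (κ j)).pot (fun _ => u x) =
        κ j * Real.logb 2 ((j.2.1 * (u x).size + max j.2.2 0 : ℤ) : ℝ) := by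
      rw [Annot.pot_eq]
      change rkPot 0 _ + lgPot (Finsupp.single _ _) _ = _
      rw [rkPot_zero, lgPot_single, logFun_eq, wsum_single, zero_add]
    have hin : (p j).pot t = ∑ i ∈ (p j).lg.support, ((p j).lg i : ℝ) *
        Real.logb 2 ((wsum i.1 t + i.2 : ℤ) : ℝ) := by
      rw [Annot.pot_eq, hc.side_rk j hj, rkPot_zero, zero_add]
      rfl
    -- `V` is positive because `d ≠ 0` and trees have at least one leaf.
    have hV : 1 ≤ (j.2.1 : ℤ) * (u x).size + max j.2.2 0 := by
      have h1 := (u x).one_le_size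
      have : 1 ≤ j.2.1 * (u x).size := Nat.one_le_iff_ne_zero.mpr (by positivity)
      have h2 : (1 : ℤ) ≤ j.2.1 * (u x).size := by exact_mod_cast this
      have := le_max_right j.2.2 0
      omega
    -- For `e ≥ 0` nothing is subtracted; for `e < 0`, `side_shift` bounds `-e` by the weight of
    -- `b`, and sizes are at least one.
    have hy : 0 ≤ wsum j.1 t - max (-j.2.2) 0 := by
      have h1 := hc.side_shift j hj hκ
      have h2 := weight_le_wsum j.1 t
      have h3 := wsum_nonneg j.1 t
      omega
    rw [hout, hin] at h
    rw [hmix]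
    -- This is the use of `side_sum`: a positive `κ` needs at least one coefficient to be compared
    -- with.
    have hns : (p j).lg.support.Nonempty := by
      rw [Finset.nonempty_iff_ne_empty]
      intro h0
      have := hc.side_sum j hj
      rw [Finsupp.sum, h0, Finset.sum_empty] at this
      exact hκ (le_antisymm this zero_le)
    have key := mul_logb_add_le hns (u := fun i => ((wsum i.1 t + i.2 : ℤ) : ℝ))
      (w := fun i => ((p j).lg i : ℝ)) hκpos (by exact_mod_cast hV)
      (by exact_mod_cast hy : (0 : ℝ) ≤ ((wsum j.1 t - max (-j.2.2) 0 : ℤ) : ℝ)) ?_ ?_ h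
    -- Since `max e 0 - max (-e) 0 = e`, the shifted argument `V + y` is the one wanted.
    · refine le_trans (le_of_eq ?_) key
      rw [logFun_eq, wsum_add, wsum_single, ← Int.cast_add,
        wsum_congr fun y hy => htu y (hjΔ hy)]
      congr 3
      simp only
      omega
    · intro i hi
      rw [Finsupp.mem_support_iff] at hi
      have : i.1 ≠ 0 := by
        intro h0
        apply hi
        rw [← hc.side_const j hj i.2, ← h0]
      exact_mod_cast hc.side_le j hj i this hi
    · intro i hi
      rw [Finsupp.mem_support_iff] at hi
      have h1 := hc.side_pos j hj i hi
      have h2 := weight_le_wsum i.1 t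
      have : 1 ≤ wsum i.1 t + i.2 := by omega
      exact_mod_cast this

theorem pot_le (hc : LetTreeConstraints Γ Δ x Q P' R I p κ) (hx : x ∉ Δ.trees)
    (hR : R.On (insert x Δ.trees))
    (hΓΔ : Disjoint Γ.trees Δ.trees) (hp : ∀ j ∈ I, (p j).On Γ.trees) {S : Set Var}
    (hQ : Q.On S) {t u : Var → Tree} (htu : ∀ y ∈ Δ.trees, u y = t y)
    (h : ∀ j ∈ I, (sideOut j.2.1 j.2.2 (κ j)).pot (fun _ => u x) ≤ (p j).pot t) :
    R.pot u ≤ P'.pot (fun _ => u x) + (Q.pot t - (Q.restrict Γ.trees).pot t) := by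
  have h1 := hc.pot_add_le hΓΔ hp hQ t
  have h2 : ∑ j ∈ I, κ j * logFun (j.1 + Finsupp.single x j.2.1, j.2.2) u ≤
      ∑ j ∈ I, lgPot (mixed p j) t :=
    Finset.sum_le_sum fun j hj => hc.mul_logFun_le hΓΔ hp hQ htu hj (h j hj)
  rw [hc.pot_eq hx hR, outerPot_congr htu]
  linarith

end LetTreeConstraints

/-! ### Substitutions -/

/-- First `σ`, then `τ`. -/
def Subst.comp (σ τ : Subst) : Subst := fun y => (σ y).or (τ y)

/-- `σ` with the variables `xs` rebound to the values `vs`. -/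
def Subst.bind (σ : Subst) (xs : List Var) (vs : List Value) : Subst :=
  (σ.erase xs).comp (.ofLists xs vs)

theorem Atom.subst_subst (σ τ : Subst) (a : Atom) :
    (a.subst σ).subst τ = a.subst (σ.comp τ) := by
  cases a with
  | val v => rfl
  | var x => cases h : σ x <;> simp [Atom.subst, Subst.comp, h]

theorem Subst.erase_comp (σ τ : Subst) (xs : List Var) :
    (σ.erase xs).comp (τ.erase xs) = (σ.comp τ).erase xs := by
  funext y
  simp only [Subst.comp, Subst.erase]
  split_ifs <;> rfl

theorem Expr.subst_subst (e : Expr) (σ τ : Subst) :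
    (e.subst σ).subst τ = e.subst (σ.comp τ) := by
  induction e generalizing σ τ <;>
    simp_all [Expr.subst, Atom.subst_subst, Subst.erase_comp]

theorem Expr.subst_erase_subst (e : Expr) (σ : Subst) (xs : List Var) (vs : List Value) :
    (e.subst (σ.erase xs)).subst (.ofLists xs vs) = e.subst (σ.bind xs vs) :=
  e.subst_subst _ _

theorem Subst.bind_of_notMem (σ : Subst) {xs : List Var} (vs : List Value) {y : Var}
    (hy : y ∉ xs) : σ.bind xs vs y = σ y := by
  have h : (Subst.ofLists xs vs) y = none := by
    rw [Subst.ofLists, List.lookup_eq_none_iff]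
    intro p hp
    have := List.of_mem_zip (a := p.1) (b := p.2) hp
    rw [bne_iff_ne]
    rintro rfl
    exact hy this.1
  rw [Subst.bind, Subst.comp, h, Subst.erase, if_neg hy, Option.or_none]

theorem Subst.bind_of_mem (σ : Subst) {xs : List Var} (vs : List Value) {y : Var}
    (hy : y ∈ xs) : σ.bind xs vs y = Subst.ofLists xs vs y := by
  rw [Subst.bind, Subst.comp, Subst.erase, if_pos hy, Option.none_or]

theorem Atom.rename_subst {ρ : Var → Var} {σ : Subst}
    (h : ∀ w, ρ w ≠ w → (σ (ρ w)).isSome) (a : Atom) :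
    (a.rename ρ).subst σ = a.subst (σ ∘ ρ) := by
  cases a with
  | val v => rfl
  | var w =>
    cases h' : σ (ρ w) with
    | some v => simp [Atom.rename, Atom.subst, h']
    | none =>
      have hw : ρ w = w := by
        by_contra hne
        simpa [h'] using h w hne
      rw [hw] at h'
      simp [Atom.rename, Atom.subst, hw, h']

theorem renameExcept_ne {ρ : Var → Var} {xs : List Var} {w : Var}
    (h : renameExcept ρ xs w ≠ w) : w ∉ xs ∧ renameExcept ρ xs w = ρ w ∧ ρ w ≠ w := by
  unfold renameExcept at *
  split_ifs at * with hw
  · exact absurd rfl h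
  · exact ⟨hw, rfl, h⟩

theorem Subst.erase_comp_renameExcept {ρ : Var → Var} (σ : Subst) {xs : List Var}
    (h : ∀ w, ρ w ≠ w → ρ w ∉ xs) : σ.erase xs ∘ renameExcept ρ xs = Subst.erase (σ ∘ ρ) xs := by
  funext w
  simp only [Function.comp, Subst.erase, renameExcept]
  by_cases hw : w ∈ xs
  · simp [hw]
  · have : ρ w ∉ xs := by
      by_cases hρ : ρ w = w
      · rwa [hρ]
      · exact h w hρ
    simp [hw, this]

/-- The two conditions on `ρ w ≠ w` have different purposes: the new name is replaced by a value, so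
it does not remain visible, and it is never bound, so it cannot be captured. -/
theorem Expr.rename_subst (e : Expr) {ρ : Var → Var} {σ : Subst}
    (h : ∀ w, ρ w ≠ w → (σ (ρ w)).isSome ∧ ρ w ∉ e.binders) :
    (e.rename ρ).subst σ = e.subst (σ ∘ ρ) := by
  -- The common argument for subexpressions below binders: bound names are exempt from renaming and
  -- erased from the substitution, and no variable is renamed to one of them.
  have under : ∀ {e : Expr} {ρ : Var → Var} {σ : Subst} (xs : List Var),
      (∀ {ρ : Var → Var} {σ : Subst}, (∀ w, ρ w ≠ w → (σ (ρ w)).isSome ∧ ρ w ∉ e.binders) →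
        (e.rename ρ).subst σ = e.subst (σ ∘ ρ)) →
      (∀ w, ρ w ≠ w → (σ (ρ w)).isSome ∧ ρ w ∉ xs ∧ ρ w ∉ e.binders) →
      (e.rename (renameExcept ρ xs)).subst (σ.erase xs) = e.subst (Subst.erase (σ ∘ ρ) xs) := by
    intro e ρ σ xs ih h
    rw [ih, Subst.erase_comp_renameExcept σ fun w hw => (h w hw).2.1]
    intro w hw
    obtain ⟨_, h2, h3⟩ := renameExcept_ne hw
    rw [h2, Subst.erase, if_neg (h w h3).2.1]
    exact ⟨(h w h3).1, (h w h3).2.2⟩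
  induction e generalizing ρ σ with
  | atom a => simp only [Expr.rename, Expr.subst, Atom.rename_subst fun w hw => (h w hw).1]
  | call f as =>
    simp only [Expr.rename, Expr.subst, List.map_map]
    congr 1
    exact List.map_congr_left fun a _ => Atom.rename_subst (fun w hw => (h w hw).1) a
  | tick c e ih => simp only [Expr.rename, Expr.subst, ih h]
  | cmp o a₁ a₂ => simp only [Expr.rename, Expr.subst, Atom.rename_subst fun w hw => (h w hw).1]
  | ite a e₁ e₂ ih₁ ih₂ =>
    simp only [Expr.binders, List.mem_append, not_or] at h
    simp only [Expr.rename, Expr.subst, Atom.rename_subst fun w hw => (h w hw).1,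
      ih₁ fun w hw => ⟨(h w hw).1, (h w hw).2.1⟩, ih₂ fun w hw => ⟨(h w hw).1, (h w hw).2.2⟩]
  | nondet e₁ e₂ ih₁ ih₂ =>
    simp only [Expr.binders, List.mem_append, not_or] at h
    simp only [Expr.rename, Expr.subst,
      ih₁ fun w hw => ⟨(h w hw).1, (h w hw).2.1⟩, ih₂ fun w hw => ⟨(h w hw).1, (h w hw).2.2⟩]
  | coin p e₁ e₂ ih₁ ih₂ =>
    simp only [Expr.binders, List.mem_append, not_or] at h
    simp only [Expr.rename, Expr.subst,
      ih₁ fun w hw => ⟨(h w hw).1, (h w hw).2.1⟩, ih₂ fun w hw => ⟨(h w hw).1, (h w hw).2.2⟩]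
  | leaf => rfl
  | node a₁ a₂ a₃ => simp only [Expr.rename, Expr.subst, Atom.rename_subst fun w hw => (h w hw).1]
  | matchTree a e₁ x₁ x₂ x₃ e₂ ih₁ ih₂ =>
    simp only [Expr.binders, List.mem_append, not_or] at h
    simp only [Expr.rename, Expr.subst, Atom.rename_subst fun w hw => (h w hw).1,
      ih₁ fun w hw => ⟨(h w hw).1, (h w hw).2.1.2⟩,
      under [x₁, x₂, x₃] ih₂ fun w hw => ⟨(h w hw).1, (h w hw).2.1.1, (h w hw).2.2⟩]
  | pair a₁ a₂ => simp only [Expr.rename, Expr.subst, Atom.rename_subst fun w hw => (h w hw).1]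
  | matchPair a x₁ x₂ e ih =>
    simp only [Expr.binders, List.mem_append, not_or] at h
    simp only [Expr.rename, Expr.subst, Atom.rename_subst fun w hw => (h w hw).1, under [x₁, x₂] ih h]
  | letIn x e₁ e₂ ih₁ ih₂ =>
    simp only [Expr.binders, List.mem_cons, List.mem_append, not_or] at h
    simp only [Expr.rename, Expr.subst, ih₁ fun w hw => ⟨(h w hw).1, (h w hw).2.2.1⟩,
      under [x] ih₂ fun w hw => ⟨(h w hw).1, by simpa using (h w hw).2.1, (h w hw).2.2.2⟩]

/-! ### Reduction steps in context -/

/-- One-step reduction in an evaluation context. -/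
inductive Step (P : Program) : Expr → ℝ≥0 → MDist Expr → Prop
  | red {e c μ} : Red P e c μ → Step P e c μ
  | letIn {x e₁ e₂ c μ} : Step P e₁ c μ →
      Step P (.letIn x e₁ e₂) c (μ.map fun y => (y.1, .letIn x y.2 e₂))

/-- Evaluation contexts are traded for recursion along nested lets, the form in which `wp_letIn_le`
consumes them. -/
theorem Step.fill {P : Program} {e : Expr} {c : ℝ≥0} {μ : MDist Expr} (h : Red P e c μ)
    (C : ECtx) : Step P (C.fill e) c (μ.map fun x => (x.1, C.fill x.2)) := by
  induction C with
  | hole => simpa [ECtx.fill] using Step.red h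
  | letIn x C e₂ ih => simpa [ECtx.fill, Function.comp_def] using Step.letIn (x := x) (e₂ := e₂) ih

theorem Step.toValue_eq_none {P : Program} {e : Expr} {c : ℝ≥0} {μ : MDist Expr}
    (h : Step P e c μ) : e.toValue = none := by
  cases h with
  | red h => cases h <;> rfl
  | letIn h => rfl

theorem Red.mass_le_one {P : Program} {e : Expr} {c : ℝ≥0} {μ : MDist Expr} (h : Red P e c μ) :
    (μ.map Prod.fst).sum ≤ 1 := by
  cases h <;> try simp
  case coin p e₁ e₂ =>
    classical
    obtain ⟨u, hu⟩ := Multiset.le_iff_exists_add.mp (Multiset.map_le_map (f := Prod.fst)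
      (Multiset.filter_le (fun x => 0 < x.1)
        ({((p.1 : ℝ≥0), e₁), (1 - (p.1 : ℝ≥0), e₂)} : MDist Expr)))
    refine (le_add_right le_rfl).trans (le_of_eq_of_le
      ((Multiset.sum_add _ u).symm.trans (congrArg Multiset.sum hu.symm)) ?_)
    have : (p.1 : ℝ≥0) ≤ 1 := by exact_mod_cast p.2
    simp [add_tsub_cancel_of_le this]

theorem Step.mass_le_one {P : Program} {e : Expr} {c : ℝ≥0} {μ : MDist Expr} (h : Step P e c μ) :
    (μ.map Prod.fst).sum ≤ 1 := by
  induction h with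
  | red h => exact h.mass_le_one
  | letIn h ih => simpa [Multiset.map_map] using ih

/-! ### Expected costs and values after finitely many steps -/

/-- The expected value of `g`. -/
noncomputable def MDist.expect {A : Type} (μ : MDist A) (g : A → ℝ≥0∞) : ℝ≥0∞ :=
  (μ.map fun x => (x.1 : ℝ≥0∞) * g x.2).sum

/-- The cost that is observed in a mode. -/
def Mode.observed : Mode → ℝ≥0∞ → ℝ≥0∞
  | .cost, c => c
  | .cf, _ => 0
  | .cfnd, _ => 0

/-- The value of `g` after a step, with the costs of the step; in the mode `cfnd`, all branches of
the step are possible. -/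
noncomputable def agg (m : Mode) (c : ℝ≥0) (μ : MDist Expr) (g : Expr → ℝ≥0∞) : ℝ≥0∞ :=
  match m with
  | .cost => c + μ.expect g
  | .cf => μ.expect g
  | .cfnd => ⨆ x ∈ μ, g x.2

theorem MDist.expect_mono {A : Type} {μ : MDist A} {g h : A → ℝ≥0∞}
    (hgh : ∀ x ∈ μ, g x.2 ≤ h x.2) : μ.expect g ≤ μ.expect h :=
  Multiset.sum_map_le_sum_map _ _ fun x hx => by gcongr; exact hgh x hx

theorem agg_mono {m : Mode} {c : ℝ≥0} {μ : MDist Expr} {g h : Expr → ℝ≥0∞}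
    (hgh : ∀ x ∈ μ, g x.2 ≤ h x.2) : agg m c μ g ≤ agg m c μ h := by
  cases m with
  | cost => exact add_le_add le_rfl (MDist.expect_mono hgh)
  | cf => exact MDist.expect_mono hgh
  | cfnd => exact iSup₂_mono hgh

theorem agg_singleton (m : Mode) (c : ℝ≥0) (e : Expr) (g : Expr → ℝ≥0∞) :
    agg m c {(1, e)} g = m.observed c + g e := by
  cases m <;> simp [agg, MDist.expect, Mode.observed]

theorem agg_map (m : Mode) (c : ℝ≥0) (μ : MDist Expr) (k : Expr → Expr) (g : Expr → ℝ≥0∞) :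
    agg m c (μ.map fun y => (y.1, k y.2)) g = agg m c μ (g ∘ k) := by
  have h : MDist.expect (μ.map fun y => (y.1, k y.2)) g = μ.expect (g ∘ k) := by
    simp [MDist.expect, Multiset.map_map]
  cases m with
  | cost => simp only [agg, h]
  | cf => exact h
  | cfnd =>
    simp only [agg, Multiset.mem_map, Function.comp]
    apply le_antisymm
    · simp only [iSup_le_iff]
      rintro _ ⟨y, hy, rfl⟩
      exact le_iSup₂ (f := fun (y : ℝ≥0 × Expr) (_ : y ∈ μ) => g (k y.2)) y hy
    · refine iSup₂_le fun y hy => ?_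
      exact le_iSup₂ (f := fun (x : ℝ≥0 × Expr)
        (_ : ∃ a ∈ μ, (a.1, k a.2) = x) => g x.2) (y.1, k y.2) ⟨y, hy, rfl⟩

theorem MDist.expect_add_mul {A : Type} (μ : MDist A) (g h : A → ℝ≥0∞) (K : ℝ≥0∞) :
    μ.expect (fun x => g x + K * h x) = μ.expect g + K * μ.expect h := by
  unfold MDist.expect
  rw [← Multiset.sum_map_mul_left, ← Multiset.sum_map_add]
  congr 1
  refine Multiset.map_congr rfl fun x _ => ?_
  ring

/-- Expectations are linear and suprema subadditive. The cost `c` is charged to the first summand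
only, hence `m.free` for the second. -/
theorem agg_add_mul_le (m : Mode) (c : ℝ≥0) (μ : MDist Expr) (g h : Expr → ℝ≥0∞) (K : ℝ≥0∞) :
    agg m c μ (fun x => g x + K * h x) ≤ agg m c μ g + K * agg m.free c μ h := by
  cases m with
  | cost => simp only [agg, Mode.free, MDist.expect_add_mul, add_assoc, le_refl]
  | cf => simp only [agg, Mode.free, MDist.expect_add_mul, le_refl]
  | cfnd =>
    refine iSup₂_le fun x hx => ?_
    exact add_le_add (le_iSup₂ (f := fun (y : ℝ≥0 × Expr) (_ : y ∈ μ) => g y.2) x hx)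
      (mul_le_mul_right (le_iSup₂ (f := fun (y : ℝ≥0 × Expr) (_ : y ∈ μ) => h y.2) x hx) K)

/-- The largest possible expected value of `f` on the values reached within `n` steps, plus the
expected costs of these steps as far as they are observed. -/
noncomputable def wp (P : Program) (m : Mode) : ℕ → (Value → ℝ≥0∞) → Expr → ℝ≥0∞
  | 0, f, e => e.toValue.elim 0 f
  | n + 1, f, e => e.toValue.elim (⨆ (c) (μ) (_ : Step P e c μ), agg m c μ (wp P m n f)) f

/-- `v` can be reached within `n` steps. -/
def Reach (P : Program) : ℕ → Expr → Value → Prop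
  | 0, e, v => e.toValue = some v
  | n + 1, e, v => e.toValue = some v ∨ ∃ c μ, Step P e c μ ∧ ∃ x ∈ μ, Reach P n x.2 v

variable {P : Program} {m : Mode} {n : ℕ} {f g : Value → ℝ≥0∞} {e : Expr}

theorem wp_value {v : Value} (h : e.toValue = some v) : wp P m n f e = f v := by
  cases n <;> simp [wp, h]

theorem wp_le {B : ℝ≥0∞} (hv : e.toValue = none)
    (h : ∀ k, n = k + 1 → ∀ c μ, Step P e c μ → agg m c μ (wp P m k f) ≤ B) :
    wp P m n f e ≤ B := by
  cases n with
  | zero => simp [wp, hv]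
  | succ k =>
    simp only [wp, hv, Option.elim_none, iSup_le_iff]
    exact h k rfl

theorem agg_le_wp {c : ℝ≥0} {μ : MDist Expr} (h : Step P e c μ) :
    agg m c μ (wp P m n f) ≤ wp P m (n + 1) f e := by
  simp only [wp, h.toValue_eq_none, Option.elim_none]
  exact le_iSup_of_le c (le_iSup_of_le μ (le_iSup_of_le h le_rfl))

theorem wp_le_wp_succ (e : Expr) : wp P m n f e ≤ wp P m (n + 1) f e := by
  induction n generalizing e with
  | zero => cases h : e.toValue <;> simp [wp, h]
  | succ n ih =>
    cases h : e.toValue with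
    | some v => rw [wp_value h, wp_value h]
    | none =>
      refine wp_le h fun k hk c μ hs => ?_
      obtain rfl : n = k := by omega
      exact (agg_mono fun x _ => ih x.2).trans (agg_le_wp hs)

/-- The restriction to reachable values matters in the let rule for trees, where the side typings
say nothing about other values. -/
theorem wp_mono_of_reach (h : ∀ v, Reach P n e v → f v ≤ g v) :
    wp P m n f e ≤ wp P m n g e := by
  induction n generalizing e with
  | zero =>
    cases he : e.toValue with
    | some v => rw [wp_value he, wp_value he]; exact h v he
    | none => simp [wp, he]
  | succ n ih =>
    cases he : e.toValue with
    | some v => rw [wp_value he, wp_value he]; exact h v (Or.inl he)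
    | none =>
      refine wp_le he fun k hk c μ hs => ?_
      obtain rfl : n = k := by omega
      exact (agg_mono fun x hx => ih fun v hv => h v (Or.inr ⟨c, μ, hs, x, hx, hv⟩)).trans
        (agg_le_wp hs)

theorem wp_mono (h : ∀ v, f v ≤ g v) : wp P m n f e ≤ wp P m n g e :=
  wp_mono_of_reach fun v _ => h v

/-- Because `cfnd` takes the supremum over the branches of each step, a bound on `wp` in this mode
holds for each outcome separately. -/
theorem Reach.le_wp {v : Value} (h : Reach P n e v) : f v ≤ wp P .cfnd n f e := by
  induction n generalizing e with
  | zero => rw [wp_value h]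
  | succ n ih =>
    rcases h with h | ⟨c, μ, hs, x, hx, hv⟩
    · rw [wp_value h]
    · refine le_trans ?_ (agg_le_wp hs)
      exact (ih hv).trans
        (le_iSup₂ (f := fun (y : ℝ≥0 × Expr) (_ : y ∈ μ) => wp P .cfnd n f y.2) x hx)

/-- A run of a let evaluates `e₁` first and then the instantiated body. Granting the full budget of
`n` steps to both phases can only increase the right-hand side. -/
theorem wp_letIn_le (x : Var) (e₁ e₂ : Expr) : wp P m n f (.letIn x e₁ e₂) ≤
    wp P m n (fun v => wp P m n f (e₂.subst (.ofLists [x] [v]))) e₁ := by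
  induction n generalizing e₁ with
  | zero => simp [wp, Expr.toValue]
  | succ n ih =>
    refine wp_le rfl fun k hk c μ hs => ?_
    obtain rfl : n = k := by omega
    cases hs with
    | red hr =>
      cases hr with
      | letIn hw =>
        rw [agg_singleton, wp_value hw]
        cases m <;> simp only [Mode.observed, ENNReal.coe_zero, zero_add] <;>
          exact wp_le_wp_succ _
    | letIn hs =>
      rw [agg_map m c _ (fun y => Expr.letIn x y e₂)]
      refine le_trans (agg_mono fun y _ => ?_) (agg_le_wp hs)
      exact (ih y.2).trans (wp_mono fun v => wp_le_wp_succ _)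

theorem wp_add_mul_le (K : ℝ≥0∞) :
    wp P m n (fun v => f v + K * g v) e ≤ wp P m n f e + K * wp P m.free n g e := by
  induction n generalizing e with
  | zero => cases h : e.toValue <;> simp [wp, h]
  | succ n ih =>
    cases h : e.toValue with
    | some v => rw [wp_value h, wp_value h, wp_value h]
    | none =>
      refine wp_le h fun k hk c μ hs => ?_
      obtain rfl : n = k := by omega
      refine (agg_mono fun x _ => ih).trans ((agg_add_mul_le _ _ _ _ _ _).trans ?_)
      gcongr <;> exact agg_le_wp hs

/-- The mass of a distribution does not increase under reduction; it may drop to less than one, as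
runs that have not reached a value are not counted. -/
theorem wp_one_le : wp P m.free n (fun _ => 1) e ≤ 1 := by
  induction n generalizing e with
  | zero => cases h : e.toValue <;> simp [wp, h]
  | succ n ih =>
    cases h : e.toValue with
    | some v => rw [wp_value h]
    | none =>
      refine wp_le h fun k hk c μ hs => ?_
      obtain rfl : n = k := by omega
      refine (agg_mono (h := fun _ => 1) fun x _ => ih).trans ?_
      have : MDist.expect μ (fun _ => 1) ≤ 1 := by
        have h1 := hs.mass_le_one
        have h2 : MDist.expect μ (fun _ => 1) = (((μ.map Prod.fst).sum : ℝ≥0) : ℝ≥0∞) := by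
          simp only [MDist.expect, mul_one]
          exact ((map_multiset_sum ENNReal.ofNNRealHom _).trans
            (by rw [Multiset.map_map]; rfl)).symm
        rw [h2]
        exact_mod_cast h1
      cases m
      · exact this
      · exact this
      · exact iSup₂_le fun _ _ => le_rfl

theorem wp_add_const_le (K : ℝ≥0∞) : wp P m n (fun v => f v + K) e ≤ wp P m n f e + K := by
  have h := wp_add_mul_le (P := P) (m := m) (n := n) (f := f) (g := fun _ => 1) (e := e) K
  simp only [mul_one] at h
  refine h.trans (add_le_add le_rfl ?_)
  calc K * _ ≤ K * 1 := by gcongr; exact wp_one_le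
    _ = K := mul_one K

/-! ### Reduction of multidistributions -/

theorem MDist.expect_sum {A : Type} {ι : Type*} (s : Finset ι) (μ : ι → MDist A)
    (g : A → ℝ≥0∞) : MDist.expect (∑ i ∈ s, μ i) g = ∑ i ∈ s, (μ i).expect g := by
  classical
  induction s using Finset.induction_on with
  | empty => simp [MDist.expect]
  | insert i s hi ih =>
    rw [Finset.sum_insert hi, Finset.sum_insert hi, ← ih]
    simp [MDist.expect]

theorem MDist.expect_scale {A : Type} (p : ℝ≥0) (μ : MDist A) (g : A → ℝ≥0∞) :
    (μ.scale p).expect g = p * μ.expect g := by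
  simp [MDist.expect, MDist.scale, Multiset.map_map, Function.comp_def,
    ← Multiset.sum_map_mul_left, mul_assoc]

/-- A scheduler's actual step is one of the candidates in the supremum, and both sides are
compatible with convex combinations. The mode `cfnd` is excluded because it does not average over
branches. -/
theorem MStep.expect_wp_le (hm : m ≠ .cfnd) {μ ν : MDist Expr} {c : ℝ≥0} (h : MStep P μ c ν) :
    m.observed c + ν.expect (wp P m n f) ≤ μ.expect (wp P m (n + 1) f) := by
  induction h with
  | @nf e he =>
    have h0 : m.observed 0 = 0 := by cases m <;> simp [Mode.observed]
    rw [ENNReal.coe_zero, h0, zero_add]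
    exact MDist.expect_mono fun x _ => wp_le_wp_succ _
  | @step C e c μ h =>
    have h1 := agg_le_wp (m := m) (n := n) (f := f) (Step.fill h C)
    have h2 : MDist.expect {((1 : ℝ≥0), C.fill e)} (wp P m (n + 1) f) =
        wp P m (n + 1) f (C.fill e) := by simp [MDist.expect]
    rw [h2]
    cases m with
    | cost => exact h1
    | cf => simpa [Mode.observed, agg] using h1
    | cfnd => exact absurd rfl hm
  | @conv k p μ ν c _ _ _ ih =>
    rw [MDist.expect_sum, MDist.expect_sum]
    simp only [MDist.expect_scale]
    have h0 : m.observed (↑(∑ i, p i * c i)) = ∑ i, (p i : ℝ≥0∞) * m.observed (c i) := by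
      cases m <;> simp [Mode.observed]
    rw [h0, ← Finset.sum_add_distrib]
    refine Finset.sum_le_sum fun i _ => ?_
    rw [← mul_add]
    gcongr
    exact ih i

theorem tsum_valueDist_mul (μ : MDist Expr) (f : Value → ℝ≥0∞) :
    ∑' v, valueDist μ v * f v = μ.expect fun e => e.toValue.elim 0 f := by
  classical
  induction μ using Multiset.induction_on with
  | empty => simp [valueDist, MDist.expect]
  | cons x μ ih =>
    have h1 : ∀ v, valueDist (x ::ₘ μ) v =
        (if x.2.toValue = some v then (x.1 : ℝ≥0∞) else 0) + valueDist μ v := by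
      intro v
      unfold valueDist
      rw [Multiset.filter_cons]
      split_ifs <;> simp
    have h2 : MDist.expect (x ::ₘ μ) (fun e => e.toValue.elim 0 f) =
        x.1 * x.2.toValue.elim 0 f + MDist.expect μ fun e => e.toValue.elim 0 f := by
      simp [MDist.expect]
    simp only [h1, add_mul]
    rw [ENNReal.tsum_add, ih, h2]
    congr 1
    cases hx : x.2.toValue with
    | none => simp
    | some w =>
      rw [tsum_eq_single w]
      · simp
      · intro v hv
        simp [hv.symm]

theorem Evaluates.le_of_wp_le (hm : m ≠ .cfnd) {c : ℝ≥0∞} {μ : Value → ℝ≥0∞} {B : ℝ≥0∞}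
    (h : Evaluates P e c μ) (hf : ∀ v, f v ≠ ∞) (hB : ∀ n, wp P m n f e ≤ B) :
    m.observed c + ∑' v, μ v * f v ≤ B := by
  obtain ⟨N, ν, w, h0, hstep, hconst, rfl, hlim⟩ := h
  have one : ∀ n k, m.observed (w n) + (ν (n + 1)).expect (wp P m k f) ≤
      (ν n).expect (wp P m (k + 1) f) := by
    intro n k
    rcases lt_or_ge (n : ℕ∞) N with hn | hn
    · exact (hstep n hn).expect_wp_le hm
    · obtain ⟨hw, hν⟩ := hconst n hn
      have h0 : m.observed 0 = 0 := by cases m <;> simp [Mode.observed]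
      rw [hw, hν, ENNReal.coe_zero, h0, zero_add]
      exact MDist.expect_mono fun x _ => wp_le_wp_succ _
  -- The number `k` of steps still granted is kept variable, since each induction step has to hand
  -- one over to the prefix.
  have many : ∀ n k, ∑ i ∈ Finset.range n, m.observed (w i) + (ν n).expect (wp P m k f) ≤
      wp P m (n + k) f e := by
    intro n
    induction n with
    | zero => intro k; simp [h0, MDist.expect]
    | succ n ih =>
      intro k
      rw [Finset.sum_range_succ, add_assoc]
      refine (add_le_add le_rfl (one n k)).trans ((ih (k + 1)).trans (le_of_eq ?_))
      congr 1; omega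
  have bound : ∀ (s : Finset Value) n,
      ∑ i ∈ Finset.range n, m.observed (w i) + ∑ v ∈ s, valueDist (ν n) v * f v ≤ B := by
    intro s n
    refine le_trans (add_le_add le_rfl (ENNReal.sum_le_tsum s)) ?_
    rw [tsum_valueDist_mul]
    exact (many n 0).trans (hB _)
  have hc : m.observed (∑' n, (w n : ℝ≥0∞)) = ∑' n, m.observed (w n) := by
    cases m <;> simp [Mode.observed]
  -- Convergence is only known value by value, so the limit is taken on finite sets of values;
  -- finiteness of `f` makes multiplication by `f v` continuous.
  rw [hc, ENNReal.tsum_eq_iSup_sum (f := fun v => μ v * f v), ENNReal.add_iSup]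
  refine iSup_le fun s => ?_
  refine le_of_tendsto' (Filter.Tendsto.add ENNReal.summable.hasSum.tendsto_sum_nat ?_) (bound s)
  exact tendsto_finsetSum s fun v _ => ENNReal.Tendsto.mul_const (hlim v) (Or.inr (hf v))

/-! ### Typed values and substitutions -/

theorem Value.HasTy.isSome_tree? {v : Value} {α : Ty} (h : v.HasTy α) :
    v.tree?.isSome ↔ α.numTrees ≠ 0 := by
  induction v generalizing α with
  | const c => cases α <;> simp_all [Value.HasTy, Value.tree?, Ty.numTrees]
  | tree t => cases α <;> simp_all [Value.HasTy, Value.tree?, Ty.numTrees]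
  | pair v w ihv ihw =>
    cases α with
    | base B => exact absurd h (by simp [Value.HasTy])
    | tree B => exact absurd h (by simp [Value.HasTy])
    | prod α β =>
      have h' : v.HasTy α ∧ w.HasTy β := by simpa [Value.HasTy] using h
      rw [Value.tree?, Option.isSome_or, Bool.or_eq_true, ihv h'.1, ihw h'.2, Ty.numTrees]
      omega

theorem Value.HasTy.exists_tree {v : Value} {B : BTy} (h : v.HasTy (.tree B)) :
    ∃ t, v = .tree t ∧ t.HasLabels B := by
  cases v <;> simp_all [Value.HasTy]

theorem Value.HasTy.exists_const {v : Value} {B : BTy} (h : v.HasTy (.base B)) :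
    ∃ c, v = .const c ∧ c.ty = B := by
  cases v <;> simp_all [Value.HasTy]

theorem Value.HasTy.exists_pair {v : Value} {α β : Ty} (h : v.HasTy (.prod α β)) :
    ∃ u w, v = .pair u w ∧ u.HasTy α ∧ w.HasTy β := by
  cases v <;> simp_all [Value.HasTy]

/-- With at most one tree in the pair, the first tree found is the one at the position selected by
`treeVar`. -/
theorem Value.getD_tree?_pair {v w : Value} {α β : Ty} (hv : v.HasTy α)
    (h : α.numTrees + β.numTrees ≤ 1) : (Value.pair v w).tree?.getD .leaf =
      if α.numTrees = 1 then v.tree?.getD .leaf else w.tree?.getD .leaf := by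
  have h1 := hv.isSome_tree?
  rw [Value.tree?]
  cases hvt : v.tree? with
  | some t =>
    rw [hvt] at h1
    have : α.numTrees = 1 := by have := h1.mp rfl; omega
    simp [this]
  | none =>
    rw [hvt] at h1
    have : α.numTrees = 0 := by by_contra h0; simpa using h1.mpr h0
    simp [this]

/-- The tree at a variable. -/
def Subst.treeAt (σ : Subst) (x : Var) : Tree := ((σ x).bind Value.tree?).getD .leaf

theorem ctxPot_eq (σ : Subst) (Q : Annot Var) : ctxPot σ Q = Q.pot σ.treeAt := rfl

theorem Subst.treeAt_of_eq_some {σ : Subst} {x : Var} {v : Value} (h : σ x = some v) :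
    σ.treeAt x = v.tree?.getD .leaf := by
  simp [Subst.treeAt, h]

theorem Subst.treeAt_congr {σ τ : Subst} {x y : Var} (h : σ x = τ y) : σ.treeAt x = τ.treeAt y := by
  simp [Subst.treeAt, h]

theorem Ctx.ext_self (Γ : Ctx) (x : Var) (α : Ty) : Γ.ext x α x = some α := by simp [Ctx.ext]

theorem Ctx.ext_of_ne (Γ : Ctx) {x y : Var} (α : Ty) (h : y ≠ x) : Γ.ext x α y = Γ y := by
  simp [Ctx.ext, h]

theorem Ctx.trees_ext_subset (Γ : Ctx) (x : Var) (α : Ty) :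
    (Γ.ext x α).trees ⊆ insert x Γ.trees := by
  rintro y ⟨β, h, hβ⟩
  by_cases hy : y = x
  · exact Or.inl hy
  · rw [Ctx.ext_of_ne Γ α hy] at h
    exact Or.inr ⟨β, h, hβ⟩

theorem Annot.On.mono {V : Type} {Q : Annot V} {S T : Set V} (h : Q.On S) (hST : S ⊆ T) : Q.On T :=
  ⟨h.1.trans hST, fun i hi => ⟨(h.2 i hi).1.trans hST, (h.2 i hi).2⟩⟩

theorem Subst.Respects.mono {σ : Subst} {Γ Δ : Ctx} (h : σ.Respects Δ)
    (hΓ : ∀ x α, Γ x = some α → Δ x = some α) : σ.Respects Γ :=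
  fun x α hx => h x α (hΓ x α hx)

theorem Subst.Respects.of_ext {σ : Subst} {Γ : Ctx} {x : Var} {α : Ty}
    (h : σ.Respects (Γ.ext x α)) (hx : Γ x = none) : σ.Respects Γ := by
  refine h.mono fun y β hy => ?_
  rw [Ctx.ext_of_ne]
  · exact hy
  · rintro rfl; simp [hx] at hy

theorem Subst.Respects.ext {τ : Subst} {Γ : Ctx} {x : Var} {α : Ty} {v : Value}
    (h : ∀ y β, Γ y = some β → y ≠ x → ∃ w, τ y = some w ∧ w.HasTy β)
    (hx : τ x = some v) (hv : v.HasTy α) : τ.Respects (Γ.ext x α) := by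
  intro y β hy
  by_cases hyx : y = x
  · subst hyx
    rw [Ctx.ext_self, Option.some.injEq] at hy
    subst hy
    exact ⟨v, hx, hv⟩
  · rw [Ctx.ext_of_ne Γ α hyx] at hy
    exact h y β hy hyx

theorem Ctx.lookup_zip {A : Type*} {xs : List Var} {as : List A} (hxs : xs.Nodup) {i : ℕ} {x : Var}
    {a : A} (hx : xs[i]? = some x) (ha : as[i]? = some a) : (xs.zip as).lookup x = some a := by
  induction xs generalizing as i with
  | nil => simp at hx
  | cons y ys ih =>
    cases as with
    | nil => simp at ha
    | cons b bs =>
      cases i with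
      | zero =>
        simp only [List.getElem?_cons_zero, Option.some.injEq] at hx ha
        simp [hx, ha]
      | succ i =>
        simp only [List.getElem?_cons_succ] at hx ha
        have hne : (x == y) = false := by
          rw [beq_eq_false_iff_ne]
          rintro rfl
          exact (List.nodup_cons.mp hxs).1 (List.mem_of_getElem? hx)
        rw [List.zip_cons_cons, List.lookup_cons, hne]
        exact ih (List.nodup_cons.mp hxs).2 hx ha

theorem Ctx.exists_of_lookup_zip {A : Type*} {xs : List Var} {as : List A} {x : Var} {a : A}
    (h : (xs.zip as).lookup x = some a) : ∃ i : ℕ, xs[i]? = some x ∧ as[i]? = some a := by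
  induction xs generalizing as with
  | nil => simp at h
  | cons y ys ih =>
    cases as with
    | nil => simp at h
    | cons b bs =>
      rw [List.zip_cons_cons, List.lookup_cons] at h
      by_cases hxy : x = y
      · subst hxy
        refine ⟨0, ?_⟩
        simpa using h
      · rw [beq_eq_false_iff_ne.mpr hxy] at h
        obtain ⟨i, hi⟩ := ih h
        exact ⟨i + 1, by simpa using hi⟩

/-! ### Soundness of the rules -/

open Classical in
/-- The potential of values of type `α`; infinite for all other values. -/
noncomputable def post (α : Ty) (Q' : Annot Unit) (v : Value) : ℝ≥0∞ :=
  if v.HasTy α then ENNReal.ofReal (valPot v Q') else ∞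

theorem post_of_hasTy {α : Ty} {Q' : Annot Unit} {v : Value} (h : v.HasTy α) :
    post α Q' v = ENNReal.ofReal (valPot v Q') := if_pos h

theorem post_of_not_hasTy {α : Ty} {Q' : Annot Unit} {v : Value} (h : ¬ v.HasTy α) :
    post α Q' v = ∞ := if_neg h

/-- Semantic validity of a judgement for evaluations of at most `n` steps. -/
def Sound (P : Program) (m : Mode) (n : ℕ) (Γ : Ctx) (Q : Annot Var) (e : Expr) (α : Ty)
    (Q' : Annot Unit) : Prop :=
  ∀ σ : Subst, σ.Respects Γ → wp P m n (post α Q') (e.subst σ) ≤ ENNReal.ofReal (ctxPot σ Q)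

theorem Typed.annotsFor {F : Mode → FName → Set FunSig} {m : Mode} {Γ : Ctx} {Q : Annot Var}
    {e : Expr} {α : Ty} {Q' : Annot Unit} (h : Typed F m Γ Q e α Q') : AnnotsFor Γ Q α Q' := by
  cases h <;> assumption

theorem ctxPot_nonneg {Γ : Ctx} {Q : Annot Var} {α : Ty} {Q' : Annot Unit}
    (h : AnnotsFor Γ Q α Q') (σ : Subst) : 0 ≤ ctxPot σ Q :=
  pot_nonneg h.1 _

variable {P : Program} {m : Mode} {n : ℕ} {Γ Δ : Ctx} {Q : Annot Var} {e e₁ e₂ : Expr} {α β : Ty}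
  {P' Q' : Annot Unit} {σ : Subst}

theorem wp_post_value {v : Value} (hv : e.toValue = some v) (hα : v.HasTy α)
    (h : valPot v Q' ≤ ctxPot σ Q) :
    wp P m n (post α Q') e ≤ ENNReal.ofReal (ctxPot σ Q) := by
  rw [wp_value hv, post_of_hasTy hα]
  exact ENNReal.ofReal_le_ofReal h

/-- A free step from an expression to another one. -/
theorem wp_le_of_step {f : Value → ℝ≥0∞} {B : ℝ≥0∞} (hv : e.toValue = none)
    (h : ∀ c μ, Step P e c μ → ∃ e', c = 0 ∧ μ = {(1, e')} ∧ wp P m n f e' ≤ B) :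
    wp P m n f e ≤ B := by
  refine wp_le hv fun k hk c μ hs => ?_
  obtain ⟨e', rfl, rfl, hB⟩ := h c μ hs
  have h0 : m.observed ((0 : ℝ≥0) : ℝ≥0∞) = 0 := by cases m <;> simp [Mode.observed]
  rw [agg_singleton, h0, zero_add]
  subst hk
  exact (wp_le_wp_succ e').trans hB

theorem post_mono (h : ∀ v : Value, v.HasTy α → valPot v Q' ≤ valPot v P') (v : Value) :
    post α Q' v ≤ post α P' v := by
  by_cases hv : v.HasTy α
  · rw [post_of_hasTy hv, post_of_hasTy hv]
    exact ENNReal.ofReal_le_ofReal (h v hv)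
  · simp [post_of_not_hasTy hv]

theorem post_add_smul_le (K : ℝ≥0) (v : Value) :
    post α (P' + K • Q') v ≤ post α P' v + K * post α Q' v := by
  by_cases hv : v.HasTy α
  · rw [post_of_hasTy hv, post_of_hasTy hv, post_of_hasTy hv, valPot, pot_add, pot_smul]
    refine ENNReal.ofReal_add_le.trans (le_of_eq ?_)
    rw [ENNReal.ofReal_mul K.coe_nonneg, ENNReal.ofReal_coe_nnreal]
    rfl
  · simp [post_of_not_hasTy hv]

theorem post_addConst_le (K : ℝ≥0) (v : Value) :
    post α (Q'.addConst K) v ≤ post α Q' v + K := by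
  by_cases hv : v.HasTy α
  · rw [post_of_hasTy hv, post_of_hasTy hv, valPot, pot_addConst]
    refine ENNReal.ofReal_add_le.trans (le_of_eq ?_)
    rw [ENNReal.ofReal_coe_nnreal]
    rfl
  · simp [post_of_not_hasTy hv]

/-! ### Let rules -/

/-- The part common to both let rules. The potential not given to `e₁` is a constant with respect to
its result, and survives the evaluation of `e₁` by `wp_add_const_le`; all that depends on the rule
is the inequality `hR` for the potential of the body. -/
theorem Sound.letIn {x : Var} {R P₁ : Annot Var} (hσΓ : σ.Respects Γ) (hσΔ : σ.Respects Δ)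
    (h₁ : Sound P m n Γ P₁ e₁ α P') (h₂ : Sound P m n (Δ.ext x α) R e₂ β Q')
    (h0 : 0 ≤ ctxPot σ P₁) (hle : ctxPot σ P₁ ≤ ctxPot σ Q)
    (hR : ∀ v, Reach P n (e₁.subst σ) v → v.HasTy α →
      ctxPot (σ.bind [x] [v]) R ≤ valPot v P' + (ctxPot σ Q - ctxPot σ P₁)) :
    wp P m n (post β Q') ((Expr.letIn x e₁ e₂).subst σ) ≤ ENNReal.ofReal (ctxPot σ Q) := by
  rw [Expr.subst]
  refine (wp_letIn_le _ _ _).trans ?_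
  have h3 : ∀ v, Reach P n (e₁.subst σ) v →
      wp P m n (post β Q') ((e₂.subst (σ.erase [x])).subst (.ofLists [x] [v])) ≤
        post α P' v + ENNReal.ofReal (ctxPot σ Q - ctxPot σ P₁) := by
    intro v hr
    by_cases hv : v.HasTy α
    · rw [Expr.subst_erase_subst, post_of_hasTy hv]
      refine (h₂ _ ?_).trans ((ENNReal.ofReal_le_ofReal (hR v hr hv)).trans ENNReal.ofReal_add_le)
      refine Subst.Respects.ext (fun y γ hy hyx => ?_) (v := v) ?_ hv
      · rw [Subst.bind_of_notMem _ _ (by simpa using hyx)]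
        exact hσΔ y γ hy
      · rw [Subst.bind_of_mem _ _ (by simp)]; simp [Subst.ofLists]
    -- For an ill-typed result the bound to be proved is infinite.
    · simp [post_of_not_hasTy hv]
  refine (wp_mono_of_reach h3).trans ((wp_add_const_le _).trans ?_)
  refine (add_le_add (h₁ σ hσΓ) le_rfl).trans (le_of_eq ?_)
  rw [← ENNReal.ofReal_add h0 (by linarith)]
  congr 1; ring

theorem Ctx.Disj.trees (h : Γ.Disj Δ) : Disjoint Γ.trees Δ.trees := by
  rw [Set.disjoint_left]
  rintro x ⟨γ, hγ, -⟩ ⟨δ, hδ, -⟩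
  rcases h x with h | h
  · rw [h] at hγ; cases hγ
  · rw [h] at hδ; cases hδ

theorem Subst.Respects.left (h : σ.Respects (Γ.union Δ)) : σ.Respects Γ :=
  h.mono fun x γ hx => by simp [Ctx.union, hx]

theorem Subst.Respects.right (h : σ.Respects (Γ.union Δ)) (hd : Γ.Disj Δ) : σ.Respects Δ :=
  h.mono fun x γ hx => by
    rcases hd x with h | h
    · simp [Ctx.union, hx, h]
    · rw [h] at hx; cases hx

theorem Ctx.notMem_trees {x : Var} (hx : Γ x = none) : x ∉ Γ.trees := by
  rintro ⟨γ, h, -⟩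
  rw [hx] at h; cases h

theorem Subst.treeAt_bind_single (σ : Subst) (x : Var) (v : Value) :
    (σ.bind [x] [v]).treeAt x = v.tree?.getD .leaf :=
  Subst.treeAt_of_eq_some (by rw [Subst.bind_of_mem _ _ (by simp)]; simp [Subst.ofLists])

theorem Subst.treeAt_bind_of_notMem (σ : Subst) {xs : List Var} (vs : List Value) {y : Var}
    (hy : y ∉ xs) : (σ.bind xs vs).treeAt y = σ.treeAt y :=
  Subst.treeAt_congr (σ.bind_of_notMem vs hy)

theorem Sound.letBase {x : Var} (hΓ : Γ.Disj Δ) (hx : Δ x = none)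
    (h₁ : Sound P m n Γ (Q.restrict Γ.trees) e₁ α P')
    (h₂ : Sound P m n (Δ.ext x α) (letBaseAnnot Δ Q P') e₂ β Q')
    (w₁ : AnnotsFor Γ (Q.restrict Γ.trees) α P') (wf : AnnotsFor (Γ.union Δ) Q β Q') :
    Sound P m n (Γ.union Δ) Q (.letIn x e₁ e₂) β Q' := by
  intro σ hσ
  refine Sound.letIn hσ.left (hσ.right hΓ) h₁ h₂ (ctxPot_nonneg w₁ σ)
    (pot_restrict_le wf.1 _ _) fun v _ hv => ?_
  refine pot_letBaseAnnot_le wf.1 w₁.2 hΓ.trees (fun y hy => ?_) _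
  refine σ.treeAt_bind_of_notMem _ ?_
  simp only [List.mem_singleton]
  rintro rfl
  exact Ctx.notMem_trees hx hy

/-- The side typings are used in the mode `cfnd` whatever `m` is: the shift inequality is applied to
each reachable result, so an inequality between expectations would not do. -/
theorem Sound.letTree {x : Var} {R : Annot Var} {I : Finset ((Var →₀ ℕ) × ℕ × ℤ)}
    {p : (Var →₀ ℕ) × ℕ × ℤ → Annot Var} {κ : (Var →₀ ℕ) × ℕ × ℤ → ℝ≥0}
    (hΓ : Γ.Disj Δ) (hx : Δ x = none) (hc : LetTreeConstraints Γ Δ x Q P' R I p κ)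
    (h₁ : Sound P m n Γ (Q.restrict Γ.trees) e₁ α P')
    (hside : ∀ j ∈ I, Sound P .cfnd n Γ (p j) e₁ α (sideOut j.2.1 j.2.2 (κ j)))
    (h₂ : Sound P m n (Δ.ext x α) R e₂ β Q')
    (w₁ : AnnotsFor Γ (Q.restrict Γ.trees) α P')
    (wside : ∀ j ∈ I, AnnotsFor Γ (p j) α (sideOut j.2.1 j.2.2 (κ j)))
    (w₂ : AnnotsFor (Δ.ext x α) R β Q') (wf : AnnotsFor (Γ.union Δ) Q β Q') :
    Sound P m n (Γ.union Δ) Q (.letIn x e₁ e₂) β Q' := by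
  intro σ hσ
  refine Sound.letIn hσ.left (hσ.right hΓ) h₁ h₂ (ctxPot_nonneg w₁ σ)
    (pot_restrict_le wf.1 _ _) fun v hr hv => ?_
  have key := hc.pot_le (Ctx.notMem_trees hx) (w₂.1.mono (Ctx.trees_ext_subset _ _ _)) hΓ.trees
    (fun j hj => (wside j hj).1) wf.1 (t := σ.treeAt) (u := (σ.bind [x] [v]).treeAt)
    (fun y hy => ?_) (fun j hj => ?_)
  · rw [Subst.treeAt_bind_single] at key
    exact key
  · refine σ.treeAt_bind_of_notMem _ ?_
    simp only [List.mem_singleton]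
    rintro rfl
    exact Ctx.notMem_trees hx hy
  -- Reachability turns the soundness of the side typing into an inequality for this particular
  -- value.
  · have h1 := (hr.le_wp (f := post α (sideOut j.2.1 j.2.2 (κ j)))).trans (hside j hj σ hσ.left)
    rw [post_of_hasTy hv, ENNReal.ofReal_le_ofReal_iff (ctxPot_nonneg (wside j hj) σ)] at h1
    rw [Subst.treeAt_bind_single]
    exact h1

/-! ### Pattern matching -/

theorem Sound.matchTree {x : Var} {B : BTy} {x₁ x₂ x₃ : Var} (hx : Γ x = none)
    (hd : [x₁, x₂, x₃].Nodup) (hx₁ : Γ x₁ = none) (hx₂ : Γ x₂ = none) (hx₃ : Γ x₃ = none)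
    (h₁ : Sound P m n Γ ((Q.atLeaf x).addConst (Q.rk x)) e₁ α Q')
    (h₂ : Sound P m n (((Γ.ext x₁ (.tree B)).ext x₂ (.base B)).ext x₃ (.tree B))
      (Q.atNode x x₁ x₃) e₂ α Q')
    (wf : AnnotsFor (Γ.ext x (.tree B)) Q α Q') :
    Sound P m n (Γ.ext x (.tree B)) Q (.matchTree (.var x) e₁ x₁ x₂ x₃ e₂) α Q' := by
  intro σ hσ
  obtain ⟨v, hv, hvB⟩ := hσ x _ (Γ.ext_self x _)
  obtain ⟨t, rfl, ht⟩ := hvB.exists_tree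
  have hσ' := hσ.of_ext hx
  have hxt : σ.treeAt x = t := Subst.treeAt_of_eq_some hv
  simp only [Expr.subst, Atom.subst, hv]
  refine wp_le_of_step rfl fun c μ hs => ?_
  cases hs with
  | red hs =>
    cases hs with
    | matchLeaf =>
      refine ⟨_, rfl, rfl, (h₁ σ hσ').trans (le_of_eq ?_)⟩
      rw [ctxPot_eq, pot_atLeaf hxt]
      rfl
    | @matchNode l b r =>
      obtain ⟨hl, hb, hr⟩ := ht
      set τ := σ.bind [x₁, x₂, x₃] [.tree l, .const b, .tree r] with hτ
      have e1 : τ x₁ = some (.tree l) :=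
        (σ.bind_of_mem _ (by simp)).trans (Ctx.lookup_zip hd (i := 0) rfl rfl)
      have e2 : τ x₂ = some (.const b) :=
        (σ.bind_of_mem _ (by simp)).trans (Ctx.lookup_zip hd (i := 1) rfl rfl)
      have e3 : τ x₃ = some (.tree r) :=
        (σ.bind_of_mem _ (by simp)).trans (Ctx.lookup_zip hd (i := 2) rfl rfl)
      have e0 : ∀ y γ, Γ y = some γ → τ y = σ y := by
        intro y γ hy
        refine σ.bind_of_notMem _ ?_
        simp only [List.mem_cons, List.not_mem_nil, or_false, not_or]
        refine ⟨?_, ?_, ?_⟩ <;> rintro rfl <;> simp_all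
      refine ⟨_, rfl, rfl, ?_⟩
      rw [Expr.subst_erase_subst, ← hτ]
      refine (h₂ τ ?_).trans (le_of_eq ?_)
      · have r1 : τ.Respects (Γ.ext x₁ (.tree B)) :=
          Subst.Respects.ext (fun y γ hy _ => e0 y γ hy ▸ hσ' y γ hy) e1 hl
        have r2 : τ.Respects ((Γ.ext x₁ (.tree B)).ext x₂ (.base B)) :=
          Subst.Respects.ext (fun y γ hy _ => r1 y γ hy) e2 hb
        exact Subst.Respects.ext (fun y γ hy _ => r2 y γ hy) e3 hr
      · rw [ctxPot_eq, pot_atNode (wf.1.mono (Ctx.trees_ext_subset _ _ _)) (t := σ.treeAt) (b := b)]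
        · rfl
        · rw [hxt, Subst.treeAt_of_eq_some e1, Subst.treeAt_of_eq_some e3]; rfl
        · rintro y hy hyx
          obtain ⟨γ, hγ, -⟩ := hy.resolve_left hyx
          exact Subst.treeAt_congr (e0 y γ hγ)

theorem Sound.matchPair {x x₁ x₂ : Var} {α₁ α₂ : Ty} (hx : Γ x = none) (hd : x₁ ≠ x₂)
    (hx₁ : Γ x₁ = none) (hx₂ : Γ x₂ = none) (hα : α₁.numTrees + α₂.numTrees ≤ 1)
    (h : Sound P m n ((Γ.ext x₁ α₁).ext x₂ α₂)
      (Q.rename (Function.update id x (treeVar x₁ x₂ α₁))) e β Q')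
    (wf : AnnotsFor (Γ.ext x (.prod α₁ α₂)) Q β Q') :
    Sound P m n (Γ.ext x (.prod α₁ α₂)) Q (.matchPair (.var x) x₁ x₂ e) β Q' := by
  intro σ hσ
  obtain ⟨v, hv, hvB⟩ := hσ x _ (Γ.ext_self x _)
  obtain ⟨u, w, rfl, hu, hw⟩ := hvB.exists_pair
  have hσ' := hσ.of_ext hx
  simp only [Expr.subst, Atom.subst, hv]
  refine wp_le_of_step rfl fun c μ hs => ?_
  cases hs with
  | red hs =>
    cases hs with
    | matchPair =>
      set τ := σ.bind [x₁, x₂] [u, w] with hτ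
      have hd' : [x₁, x₂].Nodup := by simpa using hd
      have e1 : τ x₁ = some u :=
        (σ.bind_of_mem _ (by simp)).trans (Ctx.lookup_zip hd' (i := 0) rfl rfl)
      have e2 : τ x₂ = some w :=
        (σ.bind_of_mem _ (by simp)).trans (Ctx.lookup_zip hd' (i := 1) rfl rfl)
      have e0 : ∀ y γ, Γ y = some γ → τ y = σ y := by
        intro y γ hy
        refine σ.bind_of_notMem _ ?_
        simp only [List.mem_cons, List.not_mem_nil, or_false, not_or]
        refine ⟨?_, ?_⟩ <;> rintro rfl <;> simp_all
      refine ⟨_, rfl, rfl, ?_⟩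
      rw [Expr.subst_erase_subst, ← hτ]
      refine (h τ ?_).trans (le_of_eq ?_)
      · have r1 : τ.Respects (Γ.ext x₁ α₁) :=
          Subst.Respects.ext (fun y γ hy _ => e0 y γ hy ▸ hσ' y γ hy) e1 hu
        exact Subst.Respects.ext (fun y γ hy _ => r1 y γ hy) e2 hw
      · rw [ctxPot_eq, pot_rename, ctxPot_eq,
          pot_congr (wf.1.mono (Ctx.trees_ext_subset _ _ _)) (u := σ.treeAt)]
        intro y hy
        by_cases hyx : y = x
        · subst hyx
          rw [Function.comp, Function.update_self, Subst.treeAt_of_eq_some hv,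
            Value.getD_tree?_pair hu hα, treeVar]
          split_ifs
          · exact Subst.treeAt_of_eq_some e1
          · exact Subst.treeAt_of_eq_some e2
        · obtain ⟨γ, hγ, -⟩ := hy.resolve_left hyx
          rw [Function.comp, Function.update_of_ne hyx]
          exact Subst.treeAt_congr (e0 y γ hγ)

/-! ### Branching and ticks -/

theorem Sound.ite {x : Var} (hx : Γ x = none) (h₁ : Sound P m n Γ Q e₁ α Q')
    (h₂ : Sound P m n Γ Q e₂ α Q') :
    Sound P m n (Γ.ext x (.base .bool)) Q (.ite (.var x) e₁ e₂) α Q' := by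
  intro σ hσ
  obtain ⟨v, hv, hvB⟩ := hσ x _ (Γ.ext_self x _)
  have hσ' := hσ.of_ext hx
  simp only [Expr.subst, Atom.subst, hv]
  refine wp_le_of_step rfl fun c μ hs => ?_
  cases hs with
  | red hs =>
    cases hs with
    | iteTrue => exact ⟨_, rfl, rfl, h₁ σ hσ'⟩
    | iteFalse => exact ⟨_, rfl, rfl, h₂ σ hσ'⟩

theorem Sound.nondet (h₁ : Sound P m n Γ Q e₁ α Q') (h₂ : Sound P m n Γ Q e₂ α Q') :
    Sound P m n Γ Q (.nondet e₁ e₂) α Q' := by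
  intro σ hσ
  simp only [Expr.subst]
  refine wp_le_of_step rfl fun c μ hs => ?_
  cases hs with
  | red hs =>
    cases hs with
    | nondetLeft => exact ⟨_, rfl, rfl, h₁ σ hσ⟩
    | nondetRight => exact ⟨_, rfl, rfl, h₂ σ hσ⟩

theorem MDist.expect_filter_le {A : Type} (q : ℝ≥0 × A → Prop) [DecidablePred q] (μ : MDist A)
    (g : A → ℝ≥0∞) : MDist.expect (μ.filter q) g ≤ μ.expect g := by
  conv_rhs => rw [← Multiset.filter_add_not q μ]
  rw [MDist.expect, MDist.expect, Multiset.map_add, Multiset.sum_add]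
  exact le_self_add

theorem Sound.coin {Q₁ Q₂ : Annot Var} {p : {p : ℚ≥0 // p ≤ 1}} (hm : m ≠ .cfnd)
    (h₁ : Sound P m n Γ Q₁ e₁ α Q') (h₂ : Sound P m n Γ Q₂ e₂ α Q')
    (w₁ : AnnotsFor Γ Q₁ α Q') (w₂ : AnnotsFor Γ Q₂ α Q') :
    Sound P m n Γ ((p.1 : ℝ≥0) • Q₁ + (1 - (p.1 : ℝ≥0)) • Q₂) (.coin p e₁ e₂) α Q' := by
  classical
  intro σ hσ
  simp only [Expr.subst]
  refine wp_le rfl fun k hk c μ hs => ?_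
  subst hk
  cases hs with
  | red hs =>
    cases hs with
    | coin =>
      have h0 : ∀ (ν : MDist Expr) g, agg m 0 ν g = ν.expect g := by
        intro ν g
        cases m
        · simp [agg]
        · rfl
        · exact absurd rfl hm
      rw [h0]
      -- Branches of probability zero are absent from the reduct; putting them back only adds zero
      -- terms.
      refine (MDist.expect_filter_le _ _ _).trans ?_
      simp only [MDist.expect, Multiset.insert_eq_cons, Multiset.map_cons, Multiset.map_singleton,
        Multiset.sum_cons, Multiset.sum_singleton]
      have a₁ := (wp_le_wp_succ (e₁.subst σ)).trans (h₁ σ hσ)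
      have a₂ := (wp_le_wp_succ (e₂.subst σ)).trans (h₂ σ hσ)
      refine (add_le_add (mul_le_mul_right a₁ _) (mul_le_mul_right a₂ _)).trans (le_of_eq ?_)
      rw [ctxPot_eq _ (_ + _), pot_add, pot_smul, pot_smul, ENNReal.ofReal_add,
        ENNReal.ofReal_mul (NNReal.coe_nonneg _), ENNReal.ofReal_mul (NNReal.coe_nonneg _),
        ENNReal.ofReal_coe_nnreal, ENNReal.ofReal_coe_nnreal]
      · rfl
      · exact mul_nonneg (NNReal.coe_nonneg _) (ctxPot_nonneg w₁ σ)
      · exact mul_nonneg (NNReal.coe_nonneg _) (ctxPot_nonneg w₂ σ)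

theorem Sound.coinNondet {p : {p : ℚ≥0 // p ≤ 1}}
    (h₁ : Sound P .cfnd n Γ Q e₁ α Q') (h₂ : Sound P .cfnd n Γ Q e₂ α Q') :
    Sound P .cfnd n Γ Q (.coin p e₁ e₂) α Q' := by
  intro σ hσ
  simp only [Expr.subst]
  refine wp_le rfl fun k hk c μ hs => ?_
  subst hk
  cases hs with
  | red hs =>
    cases hs with
    | coin =>
      refine iSup₂_le fun x hx => ?_
      have hx := Multiset.mem_of_mem_filter hx
      simp only [Multiset.insert_eq_cons, Multiset.mem_cons, Multiset.mem_singleton] at hx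
      rcases hx with rfl | rfl
      · exact (wp_le_wp_succ _).trans (h₁ σ hσ)
      · exact (wp_le_wp_succ _).trans (h₂ σ hσ)

theorem Sound.tickNow {c : ℚ≥0} (h : Sound P m n Γ Q e α Q') (w : AnnotsFor Γ Q α Q') :
    Sound P m n Γ (Q.addConst (m.charge c)) (.tick c e) α Q' := by
  intro σ hσ
  simp only [Expr.subst]
  refine wp_le rfl fun k hk c μ hs => ?_
  subst hk
  cases hs with
  | red hs =>
    cases hs with
    | tick =>
      have h0 : m.observed ((c : ℝ≥0) : ℝ≥0∞) = ENNReal.ofReal (m.charge c) := by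
        cases m <;> simp [Mode.observed, Mode.charge]
      rw [agg_singleton, h0, ctxPot_eq _ (Q.addConst _), pot_addConst, add_comm,
        ENNReal.ofReal_add (pot_nonneg w.1 _) (NNReal.coe_nonneg _)]
      exact add_le_add ((wp_le_wp_succ _).trans (h σ hσ)) le_rfl

/-! ### Constructors, comparison and sharing -/

theorem Sound.node {B : BTy} {x₁ x₂ x₃ : Var} (hx : [x₁, x₂, x₃].Nodup)
    (hQ' : Q'.On {_u | (Ty.tree B).numTrees = 1}) :
    Sound P m n (.ofLists [x₁, x₂, x₃] [.tree B, .base B, .tree B])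
      ((Q'.rename fun _ => x₁).atNode x₁ x₁ x₃) (.node (.var x₁) (.var x₂) (.var x₃))
      (.tree B) Q' := by
  intro σ hσ
  obtain ⟨v₁, h₁, t₁⟩ := hσ x₁ (.tree B) (Ctx.lookup_zip hx (i := 0) rfl rfl)
  obtain ⟨v₂, h₂, t₂⟩ := hσ x₂ (.base B) (Ctx.lookup_zip hx (i := 1) rfl rfl)
  obtain ⟨v₃, h₃, t₃⟩ := hσ x₃ (.tree B) (Ctx.lookup_zip hx (i := 2) rfl rfl)
  obtain ⟨l, rfl, hl⟩ := t₁.exists_tree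
  obtain ⟨b, rfl, hb⟩ := t₂.exists_const
  obtain ⟨r, rfl, hr⟩ := t₃.exists_tree
  refine wp_post_value (v := .tree (.node l b r))
    (by simp [Expr.subst, Atom.subst, h₁, h₂, h₃, Expr.toValue]) ⟨hl, hb, hr⟩ (le_of_eq ?_)
  have hon : (Q'.rename fun _ => x₁).On {x₁} := by
    refine ⟨fun y hy => ?_, fun i hi => ?_⟩
    · obtain ⟨_, _, rfl⟩ := Finset.mem_image.mp (Finsupp.mapDomain_support hy)
      rfl
    · obtain ⟨j, hj, rfl⟩ := Finset.mem_image.mp (Finsupp.mapDomain_support hi)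
      refine ⟨fun y hy => ?_, ?_⟩
      · obtain ⟨_, _, rfl⟩ := Finset.mem_image.mp (Finsupp.mapDomain_support hy)
        rfl
      · have := (hQ'.2 j hj).2
        have hw : weight (j.1.mapDomain fun _ => x₁) = weight j.1 :=
          Finsupp.sum_mapDomain_index (by simp) (by simp)
        simpa [hw] using this
  -- The output annotation is first placed at `x₁`, as if the whole node were stored there, and then
  -- unfolded into the subtrees at `x₁` and `x₃`.
  rw [ctxPot_eq, pot_atNode hon (t := fun _ => .node l b r) (b := b), pot_rename]
  · rfl
  · rw [Subst.treeAt_of_eq_some h₁, Subst.treeAt_of_eq_some h₃]; rfl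
  · intro y hy hyx
    exact absurd hy hyx

theorem Sound.cmp {o : Cmp} {B : BTy} {x₁ x₂ : Var} (hx : x₁ ≠ x₂)
    (hQ' : Q'.On {_u | (Ty.base .bool).numTrees = 1}) :
    Sound P m n (.ofLists [x₁, x₂] [.base B, .base B]) (Q'.rename fun _ => x₁)
        (.cmp o (.var x₁) (.var x₂)) (.base .bool) Q' := by
  intro σ hσ
  have hx' : [x₁, x₂].Nodup := by simpa using hx
  obtain ⟨v₁, h₁, t₁⟩ := hσ x₁ (.base B) (Ctx.lookup_zip hx' (i := 0) rfl rfl)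
  obtain ⟨v₂, h₂, t₂⟩ := hσ x₂ (.base B) (Ctx.lookup_zip hx' (i := 1) rfl rfl)
  obtain ⟨a, rfl, ha⟩ := t₁.exists_const
  obtain ⟨b, rfl, hb⟩ := t₂.exists_const
  simp only [Expr.subst, Atom.subst, h₁, h₂]
  refine wp_le_of_step rfl fun c μ hs => ?_
  cases hs with
  | red hs =>
    cases hs with
    | cmp hr =>
      rename_i r
      refine ⟨_, rfl, rfl, wp_post_value (v := .const (.bool r)) rfl rfl (le_of_eq ?_)⟩
      rw [ctxPot_eq, pot_rename]
      -- An annotation for a base type consists of constants, so the choice of trees is irrelevant.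
      exact pot_congr hQ' fun _ h => absurd h (by simp [Ty.numTrees])

theorem Sound.pair {x₁ x₂ : Var} {α₁ α₂ : Ty} (hx : x₁ ≠ x₂)
    (hα : α₁.numTrees + α₂.numTrees ≤ 1) :
    Sound P m n (.ofLists [x₁, x₂] [α₁, α₂]) (Q'.rename fun _ => treeVar x₁ x₂ α₁)
        (.pair (.var x₁) (.var x₂)) (.prod α₁ α₂) Q' := by
  intro σ hσ
  have hx' : [x₁, x₂].Nodup := by simpa using hx
  obtain ⟨v₁, h₁, t₁⟩ := hσ x₁ α₁ (Ctx.lookup_zip hx' (i := 0) rfl rfl)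
  obtain ⟨v₂, h₂, t₂⟩ := hσ x₂ α₂ (Ctx.lookup_zip hx' (i := 1) rfl rfl)
  refine wp_post_value (v := .pair v₁ v₂)
    (by simp [Expr.subst, Atom.subst, h₁, h₂, Expr.toValue]) ⟨t₁, t₂⟩ (le_of_eq ?_)
  rw [ctxPot_eq, pot_rename, valPot, Value.getD_tree?_pair t₁ hα]
  congr 1
  funext _
  rw [Function.comp, treeVar]
  split_ifs
  · exact (Subst.treeAt_of_eq_some h₁).symm
  · exact (Subst.treeAt_of_eq_some h₂).symm

/-- Instantiating the shared expression with `σ` amounts to instantiating the original one with `σ ∘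
ρ`, which gives `x` and `y` the value of `z`; the potential is transported in the same way by
`pot_rename`. -/
theorem Sound.share {x y z : Var} (hxy : x ≠ y) (hy : Γ y = none)
    (hz : Γ z = none) (hb : z ∉ e.binders) (h : Sound P m n ((Γ.ext x α).ext y α) Q e β Q') :
    Sound P m n (Γ.ext z α) (Q.rename (Function.update (Function.update id x z) y z))
        (e.rename (Function.update (Function.update id x z) y z)) β Q' := by
  intro σ hσ
  obtain ⟨v, hv, hvα⟩ := hσ z α (Γ.ext_self z α)
  have hσ' := hσ.of_ext hz
  set ρ : Var → Var := Function.update (Function.update id x z) y z with hρ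
  have ρx : ρ x = z := by simp [hρ, hxy]
  have ρy : ρ y = z := by simp [hρ]
  have ρ0 : ∀ w, w ≠ x → w ≠ y → ρ w = w := fun w h₁ h₂ => by simp [hρ, h₁, h₂]
  rw [Expr.rename_subst, ctxPot_eq, pot_rename]
  · refine h (σ ∘ ρ) ?_
    have r1 : Subst.Respects (σ ∘ ρ) (Γ.ext x α) :=
      Subst.Respects.ext (fun w γ hw hwx => by
        have hwy : w ≠ y := by rintro rfl; simp [hy] at hw
        rw [Function.comp, ρ0 w hwx hwy]
        exact hσ' w γ hw) (v := v) (by rw [Function.comp, ρx, hv]) hvα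
    exact Subst.Respects.ext (fun w γ hw _ => r1 w γ hw) (v := v)
      (by rw [Function.comp, ρy, hv]) hvα
  · intro w hw
    have : ρ w = z := by
      by_cases h₁ : w = x
      · rw [h₁, ρx]
      · by_cases h₂ : w = y
        · rw [h₂, ρy]
        · exact absurd (ρ0 w h₁ h₂) hw
    rw [this, hv]
    exact ⟨rfl, hb⟩

/-! ### Function calls -/

theorem Step.call_inv {f : FName} {as : List Atom} {c : ℝ≥0} {μ : MDist Expr}
    (h : Step P (.call f as) c μ) : ∃ d vs, as = vs.map .val ∧ P.defs f = some d ∧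
      d.params.length = vs.length ∧ c = 0 ∧ μ = {(1, d.body.subst (.ofLists d.params vs))} := by
  cases h with
  | red h =>
    cases h with
    | call hd hl => exact ⟨_, _, rfl, hd, hl, rfl, rfl⟩

theorem exists_values {xs : List Var} {αs : List Ty} (hxs : xs.Nodup)
    (hlen : xs.length = αs.length) (hσ : σ.Respects (.ofLists xs αs)) :
    ∃ vs : List Value, vs.length = xs.length ∧ (∀ (i : ℕ) x, xs[i]? = some x → σ x = vs[i]?) ∧
      ∀ (i : ℕ) v α, vs[i]? = some v → αs[i]? = some α → v.HasTy α := by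
  have key : ∀ (i : ℕ) x, xs[i]? = some x →
      ∃ α v, αs[i]? = some α ∧ σ x = some v ∧ v.HasTy α := by
    intro i x hx
    obtain ⟨hi, -⟩ := List.getElem?_eq_some_iff.mp hx
    have hα : αs[i]? = some (αs[i]'(hlen ▸ hi)) := List.getElem?_eq_getElem _
    obtain ⟨v, hv, hvα⟩ := hσ x _ (Ctx.lookup_zip hxs hx hα)
    exact ⟨_, v, hα, hv, hvα⟩
  refine ⟨xs.map fun x => (σ x).getD (.tree .leaf), by simp, fun i x hx => ?_,
    fun i v α hv hα => ?_⟩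
  · obtain ⟨_, v, -, hv, -⟩ := key i x hx
    simp [hx, hv]
  · rw [List.getElem?_map, Option.map_eq_some_iff] at hv
    obtain ⟨x, hx, rfl⟩ := hv
    obtain ⟨α', v, hα', hv, hvα⟩ := key i x hx
    rw [hα, Option.some.injEq] at hα'
    rw [hv, hα']
    exact hvα

theorem Sound.app (hP : P.WellTyped) {f : FName} {s s' : FunSig} {K : ℝ≥0} {xs : List Var}
    (ih : ∀ k, n = k + 1 → ∀ m Γ Q e α Q', Typed P.sig m Γ Q e α Q' → Sound P m k Γ Q e α Q')
    (hs : s ∈ P.sig m f) (hs' : s' ∈ P.sig m.free f) (hargs : s'.args = s.args)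
    (hres : s'.res = s.res) (hx : xs.Nodup) (hlen : xs.length = s.args.length) :
    Sound P m n (.ofLists xs s.args) ((s.inp + K • s'.inp).rename fun i => xs.getD i 0)
      (.call f (xs.map .var)) s.res (s.out + K • s'.out) := by
  intro σ hσ
  obtain ⟨vs, hvlen, hvx, hvty⟩ := exists_values hx hlen hσ
  have hsub : (Expr.call f (xs.map .var)).subst σ = .call f (vs.map .val) := by
    rw [Expr.subst, List.map_map]
    congr 1
    refine List.ext_getElem? fun i => ?_
    rw [List.getElem?_map, List.getElem?_map]
    cases hi : xs[i]? with
    | none =>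
      have : vs[i]? = none := by
        rw [List.getElem?_eq_none_iff] at hi ⊢; omega
      rw [this]; rfl
    | some x =>
      obtain ⟨hi', -⟩ := List.getElem?_eq_some_iff.mp hi
      have h1 := hvx i x hi
      have h2 : vs[i]? = some (vs[i]'(by omega)) := List.getElem?_eq_getElem _
      rw [h2] at h1 ⊢
      simp [Atom.subst, h1]
  rw [hsub]
  refine wp_le rfl fun k hk c μ hstep => ?_
  obtain ⟨d, vs', hvs, hd, hdl, rfl, rfl⟩ := hstep.call_inv
  have hinj : Function.Injective Atom.val := fun _ _ h => by injection h
  obtain rfl : vs = vs' := hinj.list_map hvs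
  have h0 : m.observed ((0 : ℝ≥0) : ℝ≥0∞) = 0 := by cases m <;> simp [Mode.observed]
  rw [agg_singleton, h0, zero_add]
  set τ := Subst.ofLists d.params vs with hτ
  have hτresp : τ.Respects (.ofLists d.params s.args) := by
    intro y γ hy
    obtain ⟨i, hi, hγ⟩ := Ctx.exists_of_lookup_zip hy
    obtain ⟨hi', -⟩ := List.getElem?_eq_some_iff.mp hi
    have h2 : vs[i]? = some (vs[i]'(by omega)) := List.getElem?_eq_getElem _
    exact ⟨_, Ctx.lookup_zip d.nodup hi h2, hvty i _ _ h2 hγ⟩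
  -- Signatures are indexed by argument positions; parameters and actual arguments hold the same
  -- tree at each position.
  have htree : ∀ i ∈ {i | ∃ α, s.args[i]? = some α ∧ α.numTrees = 1},
      τ.treeAt (d.params.getD i 0) = σ.treeAt (xs.getD i 0) := by
    rintro i ⟨γ, hγ, -⟩
    obtain ⟨hi, -⟩ := List.getElem?_eq_some_iff.mp hγ
    have h1 : d.params[i]? = some (d.params[i]'(by omega)) := List.getElem?_eq_getElem _
    have h2 : vs[i]? = some (vs[i]'(by omega)) := List.getElem?_eq_getElem _
    have h3 : xs[i]? = some (xs[i]'(by omega)) := List.getElem?_eq_getElem _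
    rw [List.getD_eq_getElem?_getD, List.getD_eq_getElem?_getD, h1, h3]
    exact Subst.treeAt_congr ((Ctx.lookup_zip d.nodup h1 h2).trans
      (h2.symm.trans (hvx i _ h3).symm))
  have b₁ := ih k hk m _ _ _ _ _ (hP m f d hd s hs).2 τ hτresp
  have b₂ := ih k hk m.free _ _ _ _ _ (hP m.free f d hd s' hs').2 τ (by rw [hargs]; exact hτresp)
  rw [ctxPot_eq, pot_rename, pot_congr (t := τ.treeAt ∘ fun i => d.params.getD i 0) s.inp_on
    (u := σ.treeAt ∘ fun i => xs.getD i 0) htree] at b₁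
  rw [ctxPot_eq, pot_rename, pot_congr (t := τ.treeAt ∘ fun i => d.params.getD i 0) s'.inp_on
    (u := σ.treeAt ∘ fun i => xs.getD i 0) (by rw [hargs]; exact htree), hres] at b₂
  -- The two bounds on the body, one with the mode of the call and one with its free mode, are
  -- combined with weights one and `K`.
  refine (wp_mono fun v => post_add_smul_le K v).trans ((wp_add_mul_le _).trans ?_)
  refine (add_le_add b₁ (mul_le_mul_right b₂ _)).trans (le_of_eq ?_)
  rw [ctxPot_eq, pot_rename, pot_add, pot_smul, ENNReal.ofReal_add (pot_nonneg s.inp_on _)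
    (mul_nonneg K.coe_nonneg (pot_nonneg s'.inp_on _)), ENNReal.ofReal_mul K.coe_nonneg,
    ENNReal.ofReal_coe_nnreal]

/-! ### The two inductions and the passage to evaluations -/

/-- The number of steps is fixed here, so premises are used with the same `n`; the hypothesis for `k
< n` enters only through calls. The modes are treated together because a let in any mode has side
premises in `cfnd`. -/
theorem Typed.sound_of_calls (hP : P.WellTyped)
    (ih : ∀ k, n = k + 1 → ∀ m Γ Q e α Q', Typed P.sig m Γ Q e α Q' → Sound P m k Γ Q e α Q')
    (h : Typed P.sig m Γ Q e α Q') : Sound P m n Γ Q e α Q' := by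
  induction h with
  | @leaf m B Q' wf =>
    intro σ _
    exact wp_post_value (v := .tree .leaf) rfl trivial (le_of_eq (pot_leafInput wf.2 _).symm)
  | node hx hQ wf => subst hQ; exact Sound.node hx wf.2
  | @const m c Q' wf =>
    intro σ _
    refine wp_post_value (v := .const c) rfl rfl (le_of_eq ?_)
    rw [ctxPot_eq, pot_rename]
    exact pot_congr wf.2 fun _ h => absurd h (by simp [Ty.numTrees])
  | cmp hx wf => exact Sound.cmp hx wf.2
  | @var m x α Q' wf =>
    intro σ hσ
    obtain ⟨v, hv, hα⟩ := hσ x α (by simp [Ctx.ofLists])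
    refine wp_post_value (v := v) (by simp [Expr.subst, Atom.subst, hv, Expr.toValue]) hα
      (le_of_eq ?_)
    rw [ctxPot_eq, pot_rename, valPot, ← Subst.treeAt_of_eq_some hv]
    rfl
  | pair hx hα wf => exact Sound.pair hx hα
  | ite hx _ _ wf ih₁ ih₂ => exact Sound.ite hx ih₁ ih₂
  | nondet _ _ wf ih₁ ih₂ => exact Sound.nondet ih₁ ih₂
  | coin hm h₁ h₂ hQ wf ih₁ ih₂ =>
    subst hQ
    exact Sound.coin hm ih₁ ih₂ h₁.annotsFor h₂.annotsFor
  | coinNondet _ _ wf ih₁ ih₂ => exact Sound.coinNondet ih₁ ih₂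
  | tickNow h wf ih₁ => exact Sound.tickNow ih₁ h.annotsFor
  | matchTree hx hd hx₁ hx₂ hx₃ _ _ wf ih₁ ih₂ =>
    exact Sound.matchTree hx hd hx₁ hx₂ hx₃ ih₁ ih₂ wf
  | matchPair hx hd hx₁ hx₂ hα _ wf ih₁ => exact Sound.matchPair hx hd hx₁ hx₂ hα ih₁ wf
  | letBase hΓ hx hα h₁ _ wf ih₁ ih₂ => exact Sound.letBase hΓ hx ih₁ ih₂ h₁.annotsFor wf
  | letTree hΓ hx hα hc h₁ hside h₂ wf ih₁ ihside ih₂ =>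
    exact Sound.letTree hΓ hx hc ih₁ ihside ih₂ h₁.annotsFor
      (fun j hj => (hside j hj).annotsFor) h₂.annotsFor wf
  | app hs hs' hargs hres hx hlen hQ hQ' wf =>
    subst hQ hQ'
    exact Sound.app hP ih hs hs' hargs hres hx hlen
  | weakenVar hx _ wf ih₁ =>
    intro σ hσ
    exact (ih₁ σ (hσ.of_ext hx)).trans (ENNReal.ofReal_le_ofReal (pot_restrict_le wf.1 _ _))
  | share hxy hx hy hz hb _ wf ih₁ => exact Sound.share hxy hy hz hb ih₁
  | weaken _ hQ hQ' wf ih₁ =>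
    intro σ hσ
    exact (wp_mono (post_mono hQ')).trans
      ((ih₁ σ hσ).trans (ENNReal.ofReal_le_ofReal (hQ σ hσ)))
  | @shift m Γ Q e α Q' K h wf ih₁ =>
    intro σ hσ
    refine (wp_mono (post_addConst_le K)).trans ((wp_add_const_le _).trans ?_)
    rw [ctxPot_eq, pot_addConst, ENNReal.ofReal_add (pot_nonneg h.annotsFor.1 _) K.coe_nonneg,
      ENNReal.ofReal_coe_nnreal]
    exact add_le_add (ih₁ σ hσ) le_rfl

theorem Typed.sound (hP : P.WellTyped) (n : ℕ) : ∀ m Γ Q e α Q', Typed P.sig m Γ Q e α Q' →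
    Sound P m n Γ Q e α Q' := by
  induction n with
  -- With no steps left a call contributes nothing, so no hypothesis about function bodies is
  -- needed.
  | zero => exact fun m Γ Q e α Q' h => h.sound_of_calls hP fun k hk => by omega
  | succ n ih =>
    refine fun m Γ Q e α Q' h => h.sound_of_calls hP fun k hk => ?_
    obtain rfl : n = k := by omega
    exact ih

theorem Typed.observed_add_expect_le (hP : P.WellTyped) (hm : m ≠ .cfnd)
    (h : Typed P.sig m Γ Q e α Q') (hσ : σ.Respects Γ) {c : ℝ≥0∞} {μ : Value → ℝ≥0∞}
    (heval : Evaluates P (e.subst σ) c μ) :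
    m.observed c + expect μ (fun v => valPot v Q') ≤ ENNReal.ofReal (ctxPot σ Q) := by
  refine heval.le_of_wp_le hm (fun v => ENNReal.ofReal_ne_top) fun n => ?_
  -- The limit requires a finite payoff, so `post` is replaced by the potential below it, which is
  -- finite on ill-typed values too.
  refine (wp_mono fun v => ?_).trans (Typed.sound hP n _ _ _ _ _ _ h σ hσ)
  by_cases hv : v.HasTy α
  · rw [post_of_hasTy hv]
  · simp [post_of_not_hasTy hv]

end ProbAmort

theorem theorem2 (P : ProbAmort.Program) (hP : P.WellTyped)
    (Γ : ProbAmort.Ctx) (Q : ProbAmort.Annot ProbAmort.Var) (e : ProbAmort.Expr)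
    (α : ProbAmort.Ty) (Q' : ProbAmort.Annot Unit)
    (σ : ProbAmort.Subst) (hσ : σ.Respects Γ)
    (c : ENNReal) (μ : ProbAmort.Value → ENNReal)
    (heval : ProbAmort.Evaluates P (e.subst σ) c μ) :
    (ProbAmort.Typed P.sig ProbAmort.Mode.cost Γ Q e α Q' →
      c + ProbAmort.expect μ (fun v => ProbAmort.valPot v Q') ≤
        ENNReal.ofReal (ProbAmort.ctxPot σ Q)) ∧
    (ProbAmort.Typed P.sig ProbAmort.Mode.cf Γ Q e α Q' →
      ProbAmort.expect μ (fun v => ProbAmort.valPot v Q') ≤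
        ENNReal.ofReal (ProbAmort.ctxPot σ Q)) := by
  refine ⟨fun h => h.observed_add_expect_le hP (by simp) hσ heval, fun h => ?_⟩
  have h1 := h.observed_add_expect_le hP (by simp) hσ heval
  rwa [ProbAmort.Mode.observed, zero_add] at h1
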